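/- Let $k$ be a field. A weak bialgebra over $k$ is a unital associative $k$-algebra $H$ that is also a coalgebra $(H,\Delta,\epsilon)$, such that $\Delta(gh)=\Delta(g)\Delta(h)$ and $$\epsilon(fgh)=\epsilon(fg_{(1)})\,\epsilon(g_{(2)}h)=\epsilon(fg_{(2)})\,\epsilon(g_{(1)}h),$$ $$1_{(1)}\otimes 1_{(2)}\otimes 1_{(3)}=(\Delta(1)\otimes 1)(1\otimes\Delta(1))=(1\otimes\Delta(1))(\Delta(1)\otimes 1)$$ for all $f,g,h\in H$. Its source and target counital maps are $\epsilon_s(h)=1_{(1)}\,\epsilon(h1_{(2)})$ and $\epsilon_t(h)=\epsilon(1_{(1)}h)\,1_{(2)}$; their images $H_s=\epsilon_s(H)$ and $H_t=\epsilon_t(H)$ are subalgebras, and $\epsilon_t$ restricts to an algebra anti-isomorphism $H_s\to H_t$. A weak bialgebra $H$ is a weak Hopf algebra if there is a $k$-linear map $S\colon H\to H$ with $$S(h_{(1)})h_{(2)}=\epsilon_s(h),\qquad h_{(1)}S(h_{(2)})=\epsilon_t(h),\qquad S(h_{(1)})h_{(2)}S(h_{(3)})=S(h)$$ for all $h\in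 H$. Theorem. Let $H$ be a weak Hopf algebra over $k$, and let $B=H/I$ be a finite-dimensional quotient weak bialgebra of $H$, where $I$ is a two-sided ideal and a coideal of $H$. The following are equivalent: 1. $B$ is a weak Hopf algebra. 2. The right $B_s$-module $B$ (with action by right multiplication) is isomorphic to the right $B_s$-module $B$ obtained by restricting the left $B_t$-module $B$ (with action by left multiplication) along $\epsilon_t\colon B_s\to B_t$; that is, there is a $k$-linear bijection $f\colon B\to B$ such that $f(by)=\epsilon_t(y)f(b)$ for all $b\in B$ and $y\in B_s$. -/

import Mathlib

open scoped TensorProduct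

section WeakBialgebra

universe u v

variable (k : Type u) (H : Type v) [Field k] [Ring H] [Algebra k H] [Coalgebra k H]

/-- An algebra and coalgebra `H` over a field `k` is a *weak bialgebra* if its comultiplication
is multiplicative (but not necessarily unital), and the counit and the unit satisfy the weakened
compatibility conditions below. -/
class IsWeakBialgebra : Prop where
  /-- `Δ(g h) = Δ(g) Δ(h)`. -/
  comul_mul (g h : H) :
    Coalgebra.comul (R := k) (g * h) = Coalgebra.comul (R := k) g * Coalgebra.comul (R := k) h
  /-- `ε(f g h) = ε(f g₁) ε(g₂ h)`. -/
  counit_mul_mul (f g h : H) :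
    Coalgebra.counit (R := k) (f * g * h) =
      LinearMap.mul' k k (TensorProduct.map
        (Coalgebra.counit ∘ₗ LinearMap.mulLeft k f) (Coalgebra.counit ∘ₗ LinearMap.mulRight k h)
        (Coalgebra.comul (R := k) g))
  /-- `ε(f g h) = ε(f g₂) ε(g₁ h)`. -/
  counit_mul_mul' (f g h : H) :
    Coalgebra.counit (R := k) (f * g * h) =
      LinearMap.mul' k k (TensorProduct.map
        (Coalgebra.counit ∘ₗ LinearMap.mulRight k h) (Coalgebra.counit ∘ₗ LinearMap.mulLeft k f)
        (Coalgebra.comul (R := k) g))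
  /-- `1₁ ⊗ 1₂ ⊗ 1₃ = (Δ(1) ⊗ 1) (1 ⊗ Δ(1))`. -/
  comul_comul_one :
    (Coalgebra.comul (R := k)).lTensor H (Coalgebra.comul (R := k) (1 : H)) =
      TensorProduct.assoc k H H H (Coalgebra.comul (R := k) (1 : H) ⊗ₜ[k] (1 : H)) *
        ((1 : H) ⊗ₜ[k] Coalgebra.comul (R := k) (1 : H))
  /-- `1₁ ⊗ 1₂ ⊗ 1₃ = (1 ⊗ Δ(1)) (Δ(1) ⊗ 1)`. -/
  comul_comul_one' :
    (Coalgebra.comul (R := k)).lTensor H (Coalgebra.comul (R := k) (1 : H)) =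
      ((1 : H) ⊗ₜ[k] Coalgebra.comul (R := k) (1 : H)) *
        TensorProduct.assoc k H H H (Coalgebra.comul (R := k) (1 : H) ⊗ₜ[k] (1 : H))

/-- The source counital map `ε_s(h) = 1₁ ε(h 1₂)`. -/
noncomputable def sourceCounit : H →ₗ[k] H where
  toFun h := TensorProduct.rid k H
    ((Coalgebra.counit ∘ₗ LinearMap.mulLeft k h).lTensor H (Coalgebra.comul (R := k) (1 : H)))
  map_add' g h := by
    have : LinearMap.mulLeft k (g + h) = LinearMap.mulLeft k g + LinearMap.mulLeft k h := by
      ext x; simp [add_mul]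
    simp [this, LinearMap.comp_add, LinearMap.lTensor_add]
  map_smul' c h := by
    have : LinearMap.mulLeft k (c • h) = c • LinearMap.mulLeft k h := by
      ext x; simp
    simp [this, LinearMap.comp_smul, LinearMap.lTensor_smul]

/-- The target counital map `ε_t(h) = ε(1₁ h) 1₂`. -/
noncomputable def targetCounit : H →ₗ[k] H where
  toFun h := TensorProduct.lid k H
    ((Coalgebra.counit ∘ₗ LinearMap.mulRight k h).rTensor H (Coalgebra.comul (R := k) (1 : H)))
  map_add' g h := by
    have : LinearMap.mulRight k (g + h) = LinearMap.mulRight k g + LinearMap.mulRight k h := by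
      ext x; simp [mul_add]
    simp [this, LinearMap.comp_add, LinearMap.rTensor_add]
  map_smul' c h := by
    have : LinearMap.mulRight k (c • h) = c • LinearMap.mulRight k h := by
      ext x; simp
    simp [this, LinearMap.comp_smul, LinearMap.rTensor_smul]

/-- The source counital subalgebra `H_s = ε_s(H)`, as a subspace of `H`. -/
noncomputable def sourceSubspace : Submodule k H := LinearMap.range (sourceCounit k H)

/-- `S` is an antipode for the weak bialgebra `H`:
`S(h₁) h₂ = ε_s(h)`, `h₁ S(h₂) = ε_t(h)` and `S(h₁) h₂ S(h₃) = S(h)`. -/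
structure IsWeakAntipode (S : H →ₗ[k] H) : Prop where
  mul_left (h : H) :
    LinearMap.mul' k H (TensorProduct.map S LinearMap.id (Coalgebra.comul (R := k) h)) =
      sourceCounit k H h
  mul_right (h : H) :
    LinearMap.mul' k H (TensorProduct.map LinearMap.id S (Coalgebra.comul (R := k) h)) =
      targetCounit k H h
  mul_mul (h : H) :
    LinearMap.mul' k H (TensorProduct.map S
      (LinearMap.mul' k H ∘ₗ TensorProduct.map LinearMap.id S ∘ₗ Coalgebra.comul (R := k))
      (Coalgebra.comul (R := k) h)) = S h

/-- A *weak Hopf algebra* is a weak bialgebra that admits an antipode. -/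
class IsWeakHopfAlgebra : Prop extends IsWeakBialgebra k H where
  exists_antipode : ∃ S : H →ₗ[k] H, IsWeakAntipode k H S

/-- The right `H_s`-module `H` (right multiplication) is isomorphic to the right `H_s`-module
`H` obtained from the left `H_t`-module `H` (left multiplication) by restriction along the
anti-isomorphism `ε_t : H_s → H_t`, in which `y ∈ H_s` sends `b` to `ε_t(y) b`. -/
def SourceTargetModulesIsomorphic : Prop :=
  ∃ f : H ≃ₗ[k] H, ∀ y ∈ sourceSubspace k H, ∀ b : H, f (b * y) = targetCounit k H y * f b

end WeakBialgebra

section Quotient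

universe u v

theorem quotient_assoc_map {k : Type u} {H : Type v} [Field k] [Ring H] [Algebra k H]
    (I : Ideal H) [I.IsTwoSided] (z : H ⊗[k] H) :
    TensorProduct.assoc k (H ⧸ I) (H ⧸ I) (H ⧸ I)
        (Algebra.TensorProduct.map (Ideal.Quotient.mkₐ k I) (Ideal.Quotient.mkₐ k I) z ⊗ₜ[k] 1) =
      Algebra.TensorProduct.map (Ideal.Quotient.mkₐ k I)
        (Algebra.TensorProduct.map (Ideal.Quotient.mkₐ k I) (Ideal.Quotient.mkₐ k I))
        (TensorProduct.assoc k H H H (z ⊗ₜ[k] 1)) := by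
  induction z with
  | zero => simp
  | tmul x y => simp
  | add x y hx hy => simp only [map_add, TensorProduct.add_tmul, hx, hy]

variable {k : Type u} {H : Type v} [Field k] [Ring H] [Algebra k H] [Coalgebra k H]
variable (I : Ideal H) [I.IsTwoSided] [(I.restrictScalars k).IsCoideal]

/-- The coalgebra structure on the quotient `H ⧸ I` by a two-sided ideal that is a coideal. -/
noncomputable instance quotientCoalgebra : Coalgebra k (H ⧸ I) :=
  inferInstanceAs (Coalgebra k (H ⧸ I.restrictScalars k))

theorem quotientCoalgebra_counit_mk (a : H) :
    Coalgebra.counit (R := k) (Ideal.Quotient.mk I a) = Coalgebra.counit (R := k) a := rfl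

theorem quotientCoalgebra_comul_mk (a : H) :
    Coalgebra.comul (R := k) (Ideal.Quotient.mk I a) =
      Algebra.TensorProduct.map (Ideal.Quotient.mkₐ k I) (Ideal.Quotient.mkₐ k I)
        (Coalgebra.comul (R := k) a) := rfl

/-- The comultiplication of the quotient on the second tensor factor, on classes. -/
theorem quotientCoalgebra_lTensor_comul_map (z : H ⊗[k] H) :
    (Coalgebra.comul (R := k)).lTensor (H ⧸ I)
        (Algebra.TensorProduct.map (Ideal.Quotient.mkₐ k I) (Ideal.Quotient.mkₐ k I) z) =
      Algebra.TensorProduct.map (Ideal.Quotient.mkₐ k I)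
        (Algebra.TensorProduct.map (Ideal.Quotient.mkₐ k I) (Ideal.Quotient.mkₐ k I))
        ((Coalgebra.comul (R := k)).lTensor H z) := by
  induction z with
  | zero => simp
  | tmul x y => simp [quotientCoalgebra_comul_mk]
  | add x y hx hy => simp only [map_add, hx, hy]

/-- The quotient of a weak bialgebra by an ideal and coideal is a weak bialgebra. -/
instance quotientIsWeakBialgebra [IsWeakBialgebra k H] : IsWeakBialgebra k (H ⧸ I) where
  comul_mul g h := by
    obtain ⟨g, rfl⟩ := Ideal.Quotient.mk_surjective g
    obtain ⟨h, rfl⟩ := Ideal.Quotient.mk_surjective h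
    rw [← map_mul, quotientCoalgebra_comul_mk, quotientCoalgebra_comul_mk,
      quotientCoalgebra_comul_mk, IsWeakBialgebra.comul_mul, map_mul]
  counit_mul_mul f g h := by
    obtain ⟨f, rfl⟩ := Ideal.Quotient.mk_surjective f
    obtain ⟨g, rfl⟩ := Ideal.Quotient.mk_surjective g
    obtain ⟨h, rfl⟩ := Ideal.Quotient.mk_surjective h
    rw [← map_mul, ← map_mul, quotientCoalgebra_comul_mk, quotientCoalgebra_counit_mk,
      IsWeakBialgebra.counit_mul_mul]
    induction Coalgebra.comul (R := k) g with
    | zero => simp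
    | tmul x y => simp [← map_mul, quotientCoalgebra_counit_mk]
    | add x y hx hy => simp only [map_add, hx, hy]
  counit_mul_mul' f g h := by
    obtain ⟨f, rfl⟩ := Ideal.Quotient.mk_surjective f
    obtain ⟨g, rfl⟩ := Ideal.Quotient.mk_surjective g
    obtain ⟨h, rfl⟩ := Ideal.Quotient.mk_surjective h
    rw [← map_mul, ← map_mul, quotientCoalgebra_comul_mk, quotientCoalgebra_counit_mk,
      IsWeakBialgebra.counit_mul_mul']
    induction Coalgebra.comul (R := k) g with
    | zero => simp
    | tmul x y => simp [← map_mul, quotientCoalgebra_counit_mk]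
    | add x y hx hy => simp only [map_add, hx, hy]
  comul_comul_one := by
    have h : Coalgebra.comul (R := k) (1 : H ⧸ I) = _ := quotientCoalgebra_comul_mk I 1
    rw [h, quotientCoalgebra_lTensor_comul_map, IsWeakBialgebra.comul_comul_one, map_mul,
      quotient_assoc_map, Algebra.TensorProduct.map_tmul, map_one (Ideal.Quotient.mkₐ k I)]
  comul_comul_one' := by
    have h : Coalgebra.comul (R := k) (1 : H ⧸ I) = _ := quotientCoalgebra_comul_mk I 1
    rw [h, quotientCoalgebra_lTensor_comul_map, IsWeakBialgebra.comul_comul_one', map_mul,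
      quotient_assoc_map, Algebra.TensorProduct.map_tmul, map_one (Ideal.Quotient.mkₐ k I)]

end Quotient

/-! ### Dimensions of Hom spaces over a semisimple algebra -/

section SemisimpleModules

open Module

universe u v w

variable {k : Type*} {Γ : Type*} [Field k] [Ring Γ] [Algebra k Γ]

/-! From (2) to (1), write `π : H → B` and β_a(b ⊗ c) = b₁ ⊗ a(b₂)c (`galoisMap`). It suffices that
the antipode S of H maps I into I. Since id * ε_s = id under convolution, β_id ∘ β_{ε_s} = β_id, so
ker β_{ε_s} ⊆ ker β_id. The elements π(h₁) ⊗ π(S(h₂))c show that im β_{ε_t} ⊆ im β_id. An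
isomorphism as in (2) makes β_{ε_s} and β_{ε_t} conjugate, hence of equal rank, and counting
dimensions gives ker β_id = ker β_{ε_s} (`ker_galoisMap_id_eq`). For h in I the element π(h₁) ⊗
π(S(h₂)) is killed by β_id and fixed by β_{ε_s}, so it is zero, and applying ε to its first leg
gives π(S(h)) = 0 (`map_antipode_eq_zero`).

From (1) to (2) no isomorphism is written down; dimensions of Hom spaces are compared. Let y in B_s
act on B by right multiplication by y (M), left multiplication by S(y) (N), left multiplication by y
(L) and right multiplication by S(y) (R). Since S = ε_t on B_s, the claim is M ≅ N. Convolution with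
S identifies, up to twists by S², Hom(N,N) with Hom(R,L), Hom(M,M) with Hom(L,R), Hom(N,M) with
Hom(R,R), and Hom(M,N) with Hom(L,L). On B_s the map S² is ε_s ∘ ε_t, which fixes the centre, and
B_s is separable, so the twists do not change isomorphism classes
(`IsSeparabilityIdempotent.exists_comp_equiv`).

Over a semisimple algebra the defect d(X,Y) = dim End X + dim End Y - dim Hom(X,Y) - dim Hom(Y,X) is
nonnegative, and vanishes only if X ≅ Y (`finrank_hom_defect`). The four identifications give d(M,N)
= -d(L,R), so both defects vanish and M ≅ N. -/

theorem finrank_linearMap_congr {X X' Y Y' : Type*}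
    [AddCommGroup X] [Module k X] [Module Γ X] [IsScalarTower k Γ X]
    [AddCommGroup X'] [Module k X'] [Module Γ X'] [IsScalarTower k Γ X']
    [AddCommGroup Y] [Module k Y] [Module Γ Y] [IsScalarTower k Γ Y]
    [AddCommGroup Y'] [Module k Y'] [Module Γ Y'] [IsScalarTower k Γ Y']
    (e : X ≃ₗ[Γ] X') (e' : Y ≃ₗ[Γ] Y') :
    finrank k (X →ₗ[Γ] Y) = finrank k (X' →ₗ[Γ] Y') := by
  refine LinearEquiv.finrank_eq
    { toFun := fun f => e'.toLinearMap ∘ₗ f ∘ₗ e.symm.toLinearMap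
      invFun := fun f => e'.symm.toLinearMap ∘ₗ f ∘ₗ e.toLinearMap
      map_add' := fun f g => by ext; simp
      map_smul' := fun c f => by
        ext x
        exact (e'.toLinearMap.restrictScalars k).map_smul c (f (e.symm x))
      left_inv := fun f => by ext; simp
      right_inv := fun f => by ext; simp }

/-- The dimension of `Hom` between two direct sums with a common summand `Z`. -/
theorem finrank_linearMap_prod {K C Z Z' : Type*}
    [AddCommGroup K] [Module k K] [Module Γ K] [IsScalarTower k Γ K] [FiniteDimensional k K]
    [AddCommGroup C] [Module k C] [Module Γ C] [IsScalarTower k Γ C] [FiniteDimensional k C]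
    [AddCommGroup Z] [Module k Z] [Module Γ Z] [IsScalarTower k Γ Z] [FiniteDimensional k Z]
    [AddCommGroup Z'] [Module k Z'] [Module Γ Z'] [IsScalarTower k Γ Z'] [FiniteDimensional k Z'] :
    finrank k (K × Z →ₗ[Γ] C × Z') = finrank k (K →ₗ[Γ] C) + finrank k (K →ₗ[Γ] Z') +
      (finrank k (Z →ₗ[Γ] C) + finrank k (Z →ₗ[Γ] Z')) := by
  rw [← (LinearMap.coprodEquiv k).finrank_eq, finrank_prod,
    ← (LinearMap.prodEquiv (R := Γ) (M := K) k).finrank_eq, finrank_prod,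
    ← (LinearMap.prodEquiv (R := Γ) (M := Z) k).finrank_eq, finrank_prod]

/-- By semisimplicity both the kernel and the image of `f` have complements, so the image is a
summand common to source and target. -/
theorem exists_linearEquiv_prod_range [IsSemisimpleRing Γ] {X : Type u} {Y : Type v}
    [AddCommGroup X] [Module k X] [Module Γ X] [IsScalarTower k Γ X]
    [AddCommGroup Y] [Module k Y] [Module Γ Y] [IsScalarTower k Γ Y]
    (f : X →ₗ[Γ] Y) :
    ∃ (C : Submodule Γ Y),
      Nonempty (X ≃ₗ[Γ] f.ker × f.range) ∧ Nonempty (Y ≃ₗ[Γ] C × f.range) := by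
  obtain ⟨Q, hQ⟩ := exists_isCompl f.ker
  obtain ⟨C, hC⟩ := exists_isCompl f.range
  refine ⟨C, ⟨(Submodule.prodEquivOfIsCompl _ _ hQ).symm.trans
    ((LinearEquiv.refl Γ _).prodCongr ?_)⟩, ⟨(Submodule.prodEquivOfIsCompl _ _ hC.symm).symm⟩⟩
  exact (Submodule.quotientEquivOfIsCompl _ _ hQ).symm.trans f.quotKerEquivRange

/-- The difference of the two sides is a quadratic form in the formal difference X - Y, by
additivity of Hom in both variables. A common summand therefore cancels. -/
theorem finrank_hom_defect_strip {X X' Y Y' Z : Type*}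
    [AddCommGroup X] [Module k X] [Module Γ X] [IsScalarTower k Γ X] [FiniteDimensional k X]
    [AddCommGroup Y] [Module k Y] [Module Γ Y] [IsScalarTower k Γ Y] [FiniteDimensional k Y]
    [AddCommGroup X'] [Module k X'] [Module Γ X'] [IsScalarTower k Γ X'] [FiniteDimensional k X']
    [AddCommGroup Y'] [Module k Y'] [Module Γ Y'] [IsScalarTower k Γ Y'] [FiniteDimensional k Y']
    [AddCommGroup Z] [Module k Z] [Module Γ Z] [IsScalarTower k Γ Z] [FiniteDimensional k Z]
    (eX : X ≃ₗ[Γ] X' × Z) (eY : Y ≃ₗ[Γ] Y' × Z)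
    (ih : finrank k (X' →ₗ[Γ] Y') + finrank k (Y' →ₗ[Γ] X') ≤
        finrank k (X' →ₗ[Γ] X') + finrank k (Y' →ₗ[Γ] Y') ∧
      (finrank k (X' →ₗ[Γ] X') + finrank k (Y' →ₗ[Γ] Y') ≤
        finrank k (X' →ₗ[Γ] Y') + finrank k (Y' →ₗ[Γ] X') → Nonempty (X' ≃ₗ[Γ] Y'))) :
    finrank k (X →ₗ[Γ] Y) + finrank k (Y →ₗ[Γ] X) ≤
        finrank k (X →ₗ[Γ] X) + finrank k (Y →ₗ[Γ] Y) ∧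
      (finrank k (X →ₗ[Γ] X) + finrank k (Y →ₗ[Γ] Y) ≤
        finrank k (X →ₗ[Γ] Y) + finrank k (Y →ₗ[Γ] X) → Nonempty (X ≃ₗ[Γ] Y)) := by
  rw [finrank_linearMap_congr (k := k) eX eY, finrank_linearMap_congr (k := k) eY eX,
    finrank_linearMap_congr (k := k) eX eX, finrank_linearMap_congr (k := k) eY eY]
  simp only [finrank_linearMap_prod]
  refine ⟨by linarith [ih.1], fun h => ?_⟩
  obtain ⟨e⟩ := ih.2 (by linarith)
  exact ⟨eX.trans ((e.prodCongr (LinearEquiv.refl Γ Z)).trans eY.symm)⟩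

theorem finrank_submodule_lt_of_linearEquiv {X K Z : Type*}
    [AddCommGroup X] [Module k X] [Module Γ X] [IsScalarTower k Γ X] [FiniteDimensional k X]
    [AddCommGroup K] [Module k K] [Module Γ K] [IsScalarTower k Γ K] [FiniteDimensional k K]
    [AddCommGroup Z] [Module k Z] [Module Γ Z] [IsScalarTower k Γ Z] [FiniteDimensional k Z]
    [Nontrivial Z] (e : X ≃ₗ[Γ] K × Z) : finrank k K < finrank k X := by
  have h : finrank k X = _ := (e.restrictScalars k).finrank_eq
  rw [h, finrank_prod]
  have := finrank_pos (R := k) (M := Z)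
  omega

/-- For finite-dimensional modules over a semisimple algebra, the symmetrized dimension of `Hom`
is a positive semidefinite form which separates isomorphism classes. -/
theorem finrank_hom_defect [IsSemisimpleRing Γ] (n : ℕ) (X : Type u) (Y : Type v)
    [AddCommGroup X] [Module k X] [Module Γ X] [IsScalarTower k Γ X] [FiniteDimensional k X]
    [AddCommGroup Y] [Module k Y] [Module Γ Y] [IsScalarTower k Γ Y] [FiniteDimensional k Y]
    (hn : finrank k X + finrank k Y = n) :
    finrank k (X →ₗ[Γ] Y) + finrank k (Y →ₗ[Γ] X) ≤
        finrank k (X →ₗ[Γ] X) + finrank k (Y →ₗ[Γ] Y) ∧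
      (finrank k (X →ₗ[Γ] X) + finrank k (Y →ₗ[Γ] Y) ≤
        finrank k (X →ₗ[Γ] Y) + finrank k (Y →ₗ[Γ] X) → Nonempty (X ≃ₗ[Γ] Y)) := by
  induction n using Nat.strong_induction_on generalizing X Y with
  | _ n ih =>
    by_cases h₁ : ∃ f : X →ₗ[Γ] Y, f ≠ 0
    · obtain ⟨f, hf⟩ := h₁
      obtain ⟨C, ⟨eX⟩, ⟨eY⟩⟩ := exists_linearEquiv_prod_range (k := k) f
      have : Nontrivial f.range :=
        Submodule.nontrivial_iff_ne_bot.2 (by rwa [Ne, LinearMap.range_eq_bot])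
      have : FiniteDimensional k C := inferInstanceAs (FiniteDimensional k (C.restrictScalars k))
      have : FiniteDimensional k f.ker :=
        inferInstanceAs (FiniteDimensional k (f.ker.restrictScalars k))
      have : FiniteDimensional k f.range :=
        inferInstanceAs (FiniteDimensional k (f.range.restrictScalars k))
      have h₂ := finrank_submodule_lt_of_linearEquiv (k := k) eX
      have h₃ := finrank_submodule_lt_of_linearEquiv (k := k) eY
      exact finrank_hom_defect_strip eX eY (ih _ (by omega) _ _ rfl)
    by_cases h₂ : ∃ f : Y →ₗ[Γ] X, f ≠ 0
    · obtain ⟨f, hf⟩ := h₂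
      obtain ⟨C, ⟨eY⟩, ⟨eX⟩⟩ := exists_linearEquiv_prod_range (k := k) f
      have : Nontrivial f.range :=
        Submodule.nontrivial_iff_ne_bot.2 (by rwa [Ne, LinearMap.range_eq_bot])
      have : FiniteDimensional k C := inferInstanceAs (FiniteDimensional k (C.restrictScalars k))
      have : FiniteDimensional k f.ker :=
        inferInstanceAs (FiniteDimensional k (f.ker.restrictScalars k))
      have : FiniteDimensional k f.range :=
        inferInstanceAs (FiniteDimensional k (f.range.restrictScalars k))
      have h₂ := finrank_submodule_lt_of_linearEquiv (k := k) eX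
      have h₃ := finrank_submodule_lt_of_linearEquiv (k := k) eY
      exact finrank_hom_defect_strip eX eY (ih _ (by omega) _ _ rfl)
    -- With no nonzero maps either way, the defect is dim End X + dim End Y. This is zero only if
    -- both identity maps are zero.
    push Not at h₁ h₂
    have : Subsingleton (X →ₗ[Γ] Y) := ⟨fun f g => by rw [h₁ f, h₁ g]⟩
    have : Subsingleton (Y →ₗ[Γ] X) := ⟨fun f g => by rw [h₂ f, h₂ g]⟩
    rw [finrank_zero_of_subsingleton (M := X →ₗ[Γ] Y),
      finrank_zero_of_subsingleton (M := Y →ₗ[Γ] X)]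
    refine ⟨Nat.zero_le _, fun h => ?_⟩
    have hX : finrank k (X →ₗ[Γ] X) = 0 := by omega
    have hY : finrank k (Y →ₗ[Γ] Y) = 0 := by omega
    rw [finrank_zero_iff] at hX hY
    have : Subsingleton X := ⟨fun x y => by
      simpa using LinearMap.congr_fun (Subsingleton.elim (LinearMap.id : X →ₗ[Γ] X) 0) (x - y) |>
        sub_eq_zero.1⟩
    have : Subsingleton Y := ⟨fun x y => by
      simpa using LinearMap.congr_fun (Subsingleton.elim (LinearMap.id : Y →ₗ[Γ] Y) 0) (x - y) |>
        sub_eq_zero.1⟩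
    exact ⟨LinearEquiv.ofSubsingleton X Y⟩

end SemisimpleModules

/-! ### Intertwiners of algebra representations -/

section Representations

open Module

variable {k : Type*} {Γ : Type*} [Field k] [Ring Γ] [Algebra k Γ]
variable {X Y : Type*} [AddCommGroup X] [Module k X] [AddCommGroup Y] [Module k Y]

/-- The space of intertwining maps between two representations of an algebra. -/
def intertwiners (ρ : Γ →ₐ[k] End k X) (σ : Γ →ₐ[k] End k Y) : Submodule k (X →ₗ[k] Y) where
  carrier := {f | ∀ r x, f (ρ r x) = σ r (f x)}
  add_mem' hf hg r x := by simp [hf r x, hg r x]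
  zero_mem' r x := by simp
  smul_mem' c f hf r x := by simp [hf r x]

theorem mem_intertwiners {ρ : Γ →ₐ[k] End k X} {σ : Γ →ₐ[k] End k Y} {f : X →ₗ[k] Y} :
    f ∈ intertwiners ρ σ ↔ ∀ r x, f (ρ r x) = σ r (f x) := Iff.rfl

/-- An algebra representation as a module, as a type synonym of the underlying space. -/
def RepModule (_ : Γ →ₐ[k] End k X) : Type _ := X

namespace RepModule

variable (ρ : Γ →ₐ[k] End k X) (σ : Γ →ₐ[k] End k Y)

instance : AddCommGroup (RepModule ρ) := inferInstanceAs (AddCommGroup X)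
instance : Module k (RepModule ρ) := inferInstanceAs (Module k X)
instance : Module Γ (RepModule ρ) := Module.compHom X ρ.toRingHom
instance [FiniteDimensional k X] : FiniteDimensional k (RepModule ρ) :=
  inferInstanceAs (FiniteDimensional k X)

instance : IsScalarTower k Γ (RepModule ρ) where
  smul_assoc c r x := by
    change ρ (c • r) (x : X) = c • ρ r (x : X)
    rw [map_smul]
    rfl

/-- Intertwining maps are the module homomorphisms. -/
def homEquiv : (RepModule ρ →ₗ[Γ] RepModule σ) ≃ₗ[k] intertwiners ρ σ where
  toFun f := ⟨(f.restrictScalars k : RepModule ρ →ₗ[k] RepModule σ), fun r x => f.map_smul r x⟩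
  invFun f := { toFun := f.1, map_add' := f.1.map_add, map_smul' := f.2 }
  map_add' _ _ := rfl
  map_smul' _ _ := rfl
  left_inv _ := rfl
  right_inv _ := rfl

end RepModule

/-- The symmetrized dimension of the spaces of intertwiners is positive semidefinite. -/
theorem finrank_intertwiners_add_le [IsSemisimpleRing Γ] [FiniteDimensional k X]
    [FiniteDimensional k Y] (ρ : Γ →ₐ[k] End k X) (σ : Γ →ₐ[k] End k Y) :
    finrank k (intertwiners ρ σ) + finrank k (intertwiners σ ρ) ≤
      finrank k (intertwiners ρ ρ) + finrank k (intertwiners σ σ) := by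
  simp only [← (RepModule.homEquiv _ _).finrank_eq]
  exact (finrank_hom_defect _ _ _ rfl).1

/-- If the symmetrized dimension of the intertwiners vanishes on the difference of two
representations, they are isomorphic. -/
theorem exists_linearEquiv_of_finrank_intertwiners_le [IsSemisimpleRing Γ]
    [FiniteDimensional k X] [FiniteDimensional k Y]
    (ρ : Γ →ₐ[k] End k X) (σ : Γ →ₐ[k] End k Y)
    (h : finrank k (intertwiners ρ ρ) + finrank k (intertwiners σ σ) ≤
      finrank k (intertwiners ρ σ) + finrank k (intertwiners σ ρ)) :
    ∃ e : X ≃ₗ[k] Y, ∀ r x, e (ρ r x) = σ r (e x) := by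
  simp only [← (RepModule.homEquiv _ _).finrank_eq] at h
  obtain ⟨e⟩ := (finrank_hom_defect _ (RepModule ρ) (RepModule σ) rfl).2 h
  exact ⟨(e.restrictScalars k : RepModule ρ ≃ₗ[k] RepModule σ), fun r x => e.map_smul r x⟩

theorem finrank_intertwiners_congr {X' Y' : Type*} [AddCommGroup X'] [Module k X']
    [AddCommGroup Y'] [Module k Y']
    {ρ : Γ →ₐ[k] End k X} {ρ' : Γ →ₐ[k] End k X'} {σ : Γ →ₐ[k] End k Y} {σ' : Γ →ₐ[k] End k Y'}
    (hρ : ∃ e : X ≃ₗ[k] X', ∀ r x, e (ρ r x) = ρ' r (e x))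
    (hσ : ∃ e : Y ≃ₗ[k] Y', ∀ r x, e (σ r x) = σ' r (e x)) :
    finrank k (intertwiners ρ σ) = finrank k (intertwiners ρ' σ') := by
  obtain ⟨e, he⟩ := hρ
  obtain ⟨e', he'⟩ := hσ
  let eρ : RepModule ρ ≃ₗ[Γ] RepModule ρ' := { e with map_smul' := he }
  let eσ : RepModule σ ≃ₗ[Γ] RepModule σ' := { e' with map_smul' := he' }
  rw [← (RepModule.homEquiv _ _).finrank_eq, ← (RepModule.homEquiv _ _).finrank_eq]
  exact finrank_linearMap_congr eρ eσ

end Representations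

/-! ### Separable algebras and twists by automorphisms fixing the centre -/

section Separability

open Module

variable {k : Type*} {Γ : Type*} [Field k] [Ring Γ] [Algebra k Γ]

/-- `e = ∑ e₁ ⊗ e₂` is a separability idempotent: `r e₁ ⊗ e₂ = e₁ ⊗ e₂ r` and `e₁ e₂ = 1`. -/
structure IsSeparabilityIdempotent (e : Γ ⊗[k] Γ) : Prop where
  tmul_one_mul (r : Γ) : (r ⊗ₜ[k] (1 : Γ)) * e = e * ((1 : Γ) ⊗ₜ[k] r)
  mul'_eq_one : LinearMap.mul' k Γ e = 1

variable {X Y : Type*} [AddCommGroup X] [Module k X] [AddCommGroup Y] [Module k Y]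

/-- The map `a ⊗ b ↦ σ(a) ∘ p ∘ ρ(b)`. -/
noncomputable def sandwich (ρ : Γ →ₐ[k] End k X) (σ : Γ →ₐ[k] End k Y) (p : X →ₗ[k] Y) :
    Γ ⊗[k] Γ →ₗ[k] X →ₗ[k] Y :=
  TensorProduct.lift (LinearMap.mk₂ k (fun a b => σ a ∘ₗ p ∘ₗ ρ b)
    (fun _ _ _ => by ext; simp) (fun _ _ _ => by ext; simp)
    (fun _ _ _ => by ext; simp) (fun _ _ _ => by ext; simp))

section sandwich

variable (ρ : Γ →ₐ[k] End k X) (σ : Γ →ₐ[k] End k Y) (p : X →ₗ[k] Y)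

@[simp]
theorem sandwich_tmul (a b : Γ) (x : X) : sandwich ρ σ p (a ⊗ₜ b) x = σ a (p (ρ b x)) := rfl

theorem sandwich_tmul_one_mul (r : Γ) (w : Γ ⊗[k] Γ) (x : X) :
    sandwich ρ σ p ((r ⊗ₜ 1) * w) x = σ r (sandwich ρ σ p w x) := by
  induction w with
  | zero => simp
  | tmul a b => simp
  | add v w hv hw => simp only [mul_add, map_add, LinearMap.add_apply, hv, hw]

theorem sandwich_mul_one_tmul (r : Γ) (w : Γ ⊗[k] Γ) (x : X) :
    sandwich ρ σ p (w * (1 ⊗ₜ r)) x = sandwich ρ σ p w (ρ r x) := by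
  induction w with
  | zero => simp
  | tmul a b => simp
  | add v w hv hw => simp only [add_mul, map_add, LinearMap.add_apply, hv, hw]

/-- Averaging over e: the relation r e₁ ⊗ e₂ = e₁ ⊗ e₂ r carries r from the left of e₁ p e₂ to its
right, whatever the linear map p. -/
theorem IsSeparabilityIdempotent.sandwich_mem {e : Γ ⊗[k] Γ} (he : IsSeparabilityIdempotent e) :
    sandwich ρ σ p e ∈ intertwiners ρ σ := fun r x => by
  rw [← sandwich_mul_one_tmul, ← he.tmul_one_mul, sandwich_tmul_one_mul]

theorem sandwich_lmul (w : Γ ⊗[k] Γ) (p : Γ →ₗ[k] Γ) (L : Ideal Γ) (hp : ∀ x ∈ L, p x = x)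
    {x : Γ} (hx : x ∈ L) :
    sandwich (Algebra.lmul k Γ) (Algebra.lmul k Γ) p w x = LinearMap.mul' k Γ w * x := by
  induction w with
  | zero => simp
  | tmul a b => simp [hp _ (L.mul_mem_left b hx), mul_assoc]
  | add v w hv hw => simp only [map_add, LinearMap.add_apply, hv, hw, add_mul]

theorem sandwich_lmul_mem (w : Γ ⊗[k] Γ) (p : Γ →ₗ[k] Γ) (L : Ideal Γ) (hp : ∀ x, p x ∈ L)
    (x : Γ) : sandwich (Algebra.lmul k Γ) (Algebra.lmul k Γ) p w x ∈ L := by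
  induction w with
  | zero => simp
  | tmul a b => exact L.mul_mem_left _ (hp _)
  | add v w hv hw =>
    rw [map_add, LinearMap.add_apply]
    exact L.add_mem hv hw

end sandwich

/-- An algebra over a field with a separability idempotent is semisimple. -/
theorem IsSeparabilityIdempotent.isSemisimpleRing {e : Γ ⊗[k] Γ}
    (he : IsSeparabilityIdempotent e) : IsSemisimpleRing Γ := by
  refine { exists_isCompl := fun L => ?_ }
  obtain ⟨q, hq⟩ := (L.restrictScalars k).subtype.exists_leftInverse_of_injective
    (LinearMap.ker_eq_bot.2 Subtype.val_injective)
  let p : Γ →ₗ[k] Γ := (L.restrictScalars k).subtype ∘ₗ q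
  have hp : ∀ x ∈ L, p x = x := fun x hx => by
    simpa [p] using congrArg Subtype.val (LinearMap.congr_fun hq ⟨x, hx⟩)
  have hp' : ∀ x, p x ∈ L := fun x => (q x).2
  -- Averaging the linear projection over e makes it Γ-linear, and it still fixes L because e₁ e₂ =
  -- 1.
  let f : Γ →ₗ[Γ] L :=
    { toFun := fun x => ⟨_, sandwich_lmul_mem e p L hp' x⟩
      map_add' := fun x y => by ext; simp
      map_smul' := fun r x => by
        ext
        simpa using he.sandwich_mem (Algebra.lmul k Γ) (Algebra.lmul k Γ) p r x }
  exact ⟨_, LinearMap.isCompl_of_proj (f := f) fun x => by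
    ext
    simp [f, sandwich_lmul e p L hp x.2, he.mul'_eq_one]⟩

/-- The separability idempotent of the opposite algebra. -/
theorem IsSeparabilityIdempotent.op {e : Γ ⊗[k] Γ} (he : IsSeparabilityIdempotent e) :
    IsSeparabilityIdempotent (TensorProduct.map (MulOpposite.opLinearEquiv k).toLinearMap
      (MulOpposite.opLinearEquiv k).toLinearMap (TensorProduct.comm k Γ Γ e)) := by
  have h₁ (r : Γ) (w : Γ ⊗[k] Γ) :
      (MulOpposite.op r ⊗ₜ[k] (1 : Γᵐᵒᵖ)) *
        (TensorProduct.map (MulOpposite.opLinearEquiv k).toLinearMap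
        (MulOpposite.opLinearEquiv k).toLinearMap (TensorProduct.comm k Γ Γ w)) =
        (TensorProduct.map (MulOpposite.opLinearEquiv k).toLinearMap
        (MulOpposite.opLinearEquiv k).toLinearMap
          (TensorProduct.comm k Γ Γ (w * ((1 : Γ) ⊗ₜ[k] r)))) := by
    induction w with
    | zero => simp
    | tmul a b => simp
    | add v w hv hw => simp only [mul_add, add_mul, map_add, hv, hw]
  have h₂ (r : Γ) (w : Γ ⊗[k] Γ) :
        (TensorProduct.map (MulOpposite.opLinearEquiv k).toLinearMap
        (MulOpposite.opLinearEquiv k).toLinearMap (TensorProduct.comm k Γ Γ w)) *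
        ((1 : Γᵐᵒᵖ) ⊗ₜ[k] MulOpposite.op r) =
        (TensorProduct.map (MulOpposite.opLinearEquiv k).toLinearMap
        (MulOpposite.opLinearEquiv k).toLinearMap
          (TensorProduct.comm k Γ Γ ((r ⊗ₜ[k] (1 : Γ)) * w))) := by
    induction w with
    | zero => simp
    | tmul a b => simp
    | add v w hv hw => simp only [mul_add, add_mul, map_add, hv, hw]
  have h₃ (w : Γ ⊗[k] Γ) : LinearMap.mul' k Γᵐᵒᵖ
      (TensorProduct.map (MulOpposite.opLinearEquiv k).toLinearMap
        (MulOpposite.opLinearEquiv k).toLinearMap (TensorProduct.comm k Γ Γ w)) =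
      MulOpposite.op (LinearMap.mul' k Γ w) := by
    induction w with
    | zero => simp
    | tmul a b => simp
    | add v w hv hw => simp only [map_add, hv, hw, MulOpposite.op_add]
  exact ⟨fun r => by rw [← MulOpposite.op_unop r, h₁, h₂, he.tmul_one_mul],
    by rw [h₃, he.mul'_eq_one, MulOpposite.op_one]⟩

theorem tensorProduct_eq_zero_of_lTensor [FiniteDimensional k X] (t : Y ⊗[k] X)
    (h : ∀ φ : X →ₗ[k] k, TensorProduct.rid k Y (φ.lTensor Y t) = 0) : t = 0 := by
  let b := Module.finBasis k X
  apply (TensorProduct.equivFinsuppOfBasisRight (M := Y) b).injective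
  ext i
  rw [map_zero, Finsupp.zero_apply, ← h (b.coord i)]
  clear h
  induction t with
  | zero => simp
  | tmul y x => simp
  | add v w hv hw => simp only [map_add, Finsupp.add_apply, hv, hw]

/-- For the rank-one map p = φ(·)y, the sandwich sends x to φ(ρ(e₂)x) σ(e₁)y. As φ, x and y vary
these are all the matrix coefficients of (σ ⊗ ρ)(e). -/
theorem map_toLinearMap_eq_zero_of_sandwich_eq_zero [FiniteDimensional k X] [FiniteDimensional k Y]
    (ρ : Γ →ₐ[k] End k X) (σ : Γ →ₐ[k] End k Y) (e : Γ ⊗[k] Γ)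
    (h : ∀ p : X →ₗ[k] Y, sandwich ρ σ p e = 0) :
    TensorProduct.map σ.toLinearMap ρ.toLinearMap e = 0 := by
  apply (homTensorHomEquiv k Y X Y X).injective
  rw [map_zero]
  ext y x
  simp only [TensorProduct.AlgebraTensorModule.curry_apply, TensorProduct.curry_apply,
    LinearMap.coe_restrictScalars, LinearMap.zero_apply]
  apply tensorProduct_eq_zero_of_lTensor
  intro φ
  have := LinearMap.congr_fun (h (φ.smulRight y)) x
  rw [LinearMap.zero_apply] at this
  rw [← this]
  clear h this
  induction e with
  | zero => simp
  | tmul a b => simp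
  | add v w hv hw => simp only [map_add, LinearMap.add_apply, hv, hw]

/-- Two finite-dimensional representations of a separable algebra without nonzero intertwiners are
separated by a central element. -/
theorem IsSeparabilityIdempotent.exists_central {e : Γ ⊗[k] Γ} (he : IsSeparabilityIdempotent e)
    [FiniteDimensional k X] [FiniteDimensional k Y]
    (ρ : Γ →ₐ[k] End k X) (σ : Γ →ₐ[k] End k Y) (h : ∀ p : X →ₗ[k] Y, sandwich ρ σ p e = 0) :
    ∃ c : Γ, (∀ r, r * c = c * r) ∧ ρ c = 0 ∧ σ c = 1 := by
  -- Corestricting to the images makes both maps surjective, so the kernel of their tensor product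
  -- is Γ ⊗ ker ρ + ker σ ⊗ Γ.
  have h₁ : TensorProduct.map σ.toLinearMap.rangeRestrict ρ.toLinearMap.rangeRestrict e = 0 := by
    apply TensorProduct.map_injective_of_flat_flat σ.toLinearMap.range.subtype
      ρ.toLinearMap.range.subtype Subtype.val_injective Subtype.val_injective
    rw [map_zero, ← map_toLinearMap_eq_zero_of_sandwich_eq_zero ρ σ e h,
      ← LinearMap.comp_apply, ← TensorProduct.map_comp]
    rfl
  have h₂ := TensorProduct.map_ker
    (LinearMap.exact_subtype_ker_map σ.toLinearMap.rangeRestrict)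
    σ.toLinearMap.surjective_rangeRestrict
    (LinearMap.exact_subtype_ker_map ρ.toLinearMap.rangeRestrict)
    ρ.toLinearMap.surjective_rangeRestrict
  have h₃ := LinearMap.mem_ker.2 h₁
  rw [h₂] at h₃
  obtain ⟨_, ⟨u, rfl⟩, _, ⟨v, rfl⟩, huv⟩ := Submodule.mem_sup.1 h₃
  -- Multiplying out the two parts of e gives 1 = s + t, where s lies in the ideal ker ρ and t in
  -- the ideal ker σ.
  set s := LinearMap.mul' k Γ (LinearMap.lTensor Γ (LinearMap.ker _).subtype u) with hs
  set t := LinearMap.mul' k Γ (LinearMap.rTensor Γ (LinearMap.ker _).subtype v) with ht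
  have hst : s + t = 1 := by rw [hs, ht, ← map_add, huv, he.mul'_eq_one]
  have hρs : ρ s = 0 := by
    rw [hs]
    clear huv hs hst s
    induction u with
    | zero => simp
    | tmul a b =>
      have : ρ b.1 = 0 := congrArg Subtype.val (LinearMap.mem_ker.1 b.2)
      simp [this]
    | add v w hv hw => simp only [map_add, hv, hw, add_zero]
  have hσt : σ t = 0 := by
    rw [ht]
    clear huv ht hst t
    induction v with
    | zero => simp
    | tmul a b =>
      have : σ a.1 = 0 := congrArg Subtype.val (LinearMap.mem_ker.1 a.2)
      simp [this]
    | add v w hv hw => simp only [map_add, hv, hw, add_zero]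
  have hσs : σ s = 1 := by
    rw [← map_one σ, ← hst, map_add, hσt, add_zero]
  -- The element c = e₁ s e₂ is central by averaging. It is killed by ρ since ρ(s) = 0, and σ(c) =
  -- σ(e₁ e₂) = 1 since σ(s) = 1.
  refine ⟨sandwich (Algebra.lmul k Γ) (Algebra.lmul k Γ) (Algebra.lmul k Γ s) e 1,
    fun r => ?_, ?_, ?_⟩
  · have h₄ := he.sandwich_mem (Algebra.lmul k Γ) (Algebra.lmul k Γ) (Algebra.lmul k Γ s) r 1
    have h₅ (w : Γ ⊗[k] Γ) :
        sandwich (Algebra.lmul k Γ) (Algebra.lmul k Γ) (Algebra.lmul k Γ s) w r =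
        sandwich (Algebra.lmul k Γ) (Algebra.lmul k Γ) (Algebra.lmul k Γ s) w 1 * r := by
      induction w with
      | zero => simp
      | tmul a b => simp [mul_assoc]
      | add v w hv hw => simp only [map_add, LinearMap.add_apply, hv, hw, add_mul]
    rw [← h₅]
    simpa using h₄.symm
  · clear h h₁ h₃ huv he
    induction e with
    | zero => simp
    | tmul a b => simp [hρs]
    | add v w hv hw => simp only [map_add, LinearMap.add_apply, hv, hw, add_zero]
  · have h₄ (w : Γ ⊗[k] Γ) :
        σ (sandwich (Algebra.lmul k Γ) (Algebra.lmul k Γ) (Algebra.lmul k Γ s) w 1) =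
        σ (LinearMap.mul' k Γ w) := by
      induction w with
      | zero => simp
      | tmul a b => simp [hσs]
      | add v w hv hw => simp only [map_add, LinearMap.add_apply, hv, hw]
    rw [h₄, he.mul'_eq_one, map_one]

/-- A simple module over a separable algebra is isomorphic to its twist by an automorphism which
fixes the centre. -/
theorem IsSeparabilityIdempotent.exists_twist_equiv_of_isSimpleModule {e : Γ ⊗[k] Γ}
    (he : IsSeparabilityIdempotent e) (θ : Γ →ₐ[k] Γ) (hθ : Function.Surjective θ)
    (hc : ∀ c : Γ, (∀ r, r * c = c * r) → θ c = c)
    [Module Γ X] [IsScalarTower k Γ X] [FiniteDimensional k X] [IsSimpleModule Γ X] :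
    ∃ g : X ≃ₗ[k] X, ∀ (r : Γ) (x : X), g (θ r • x) = r • g x := by
  let ρ : Γ →ₐ[k] End k X := Algebra.lsmul k k X
  have hX : Nontrivial X := IsSimpleModule.nontrivial Γ X
  -- Otherwise some central c acts as 0 through ρ ∘ θ and as 1 through ρ, although θ(c) = c.
  have h : ∃ p : X →ₗ[k] X, sandwich (ρ.comp θ) ρ p e ≠ 0 := by
    by_contra! h
    obtain ⟨c, hc₁, hc₂, hc₃⟩ := he.exists_central (ρ.comp θ) ρ h
    rw [AlgHom.comp_apply, hc c hc₁, hc₃] at hc₂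
    exact one_ne_zero hc₂
  obtain ⟨p, hp⟩ := h
  set f := sandwich (ρ.comp θ) ρ p e
  have hf : ∀ r x, f (θ r • x) = r • f x := he.sandwich_mem (ρ.comp θ) ρ p
  -- Schur's argument: surjectivity of θ makes the kernel of f stable under all of Γ, so simplicity
  -- applies to it.
  let K : Submodule Γ X :=
    { f.ker with
      smul_mem' := fun r x hx => by
        obtain ⟨r, rfl⟩ := hθ r
        have hx : f x = 0 := hx
        change f (θ r • x) = 0
        rw [hf, hx, smul_zero] }
  have hK : f.ker = ⊥ := by
    rcases eq_bot_or_eq_top K with hK | hK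
    · ext x
      exact (SetLike.ext_iff.1 hK x)
    · refine absurd (LinearMap.ext fun x => ?_) hp
      exact (SetLike.ext_iff.1 hK x).2 trivial
  exact ⟨LinearEquiv.ofInjectiveEndo f (LinearMap.ker_eq_bot.1 hK), hf⟩

/-- A finite-dimensional module over a separable algebra is isomorphic to its twist by an
automorphism which fixes the centre. -/
theorem IsSeparabilityIdempotent.exists_twist_equiv {e : Γ ⊗[k] Γ}
    (he : IsSeparabilityIdempotent e) (θ : Γ →ₐ[k] Γ) (hθ : Function.Surjective θ)
    (hc : ∀ c : Γ, (∀ r, r * c = c * r) → θ c = c) (n : ℕ) (X : Type*)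
    [AddCommGroup X] [Module k X] [Module Γ X] [IsScalarTower k Γ X] [FiniteDimensional k X]
    (hn : finrank k X = n) :
    ∃ g : X ≃ₗ[k] X, ∀ (r : Γ) (x : X), g (θ r • x) = r • g x := by
  have := he.isSemisimpleRing
  induction n using Nat.strong_induction_on generalizing X with
  | _ n ih =>
    rcases subsingleton_or_nontrivial X with h | h
    · exact ⟨LinearEquiv.refl k X, fun r x => Subsingleton.elim _ _⟩
    obtain ⟨Z, hZ⟩ := IsSemisimpleModule.exists_simple_submodule Γ X
    obtain ⟨C, hC⟩ := exists_isCompl Z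
    have : FiniteDimensional k C := inferInstanceAs (FiniteDimensional k (C.restrictScalars k))
    have : FiniteDimensional k Z := inferInstanceAs (FiniteDimensional k (Z.restrictScalars k))
    have := IsSimpleModule.nontrivial Γ Z
    let E := Submodule.prodEquivOfIsCompl C Z hC.symm
    obtain ⟨g₁, h₁⟩ := ih _ (hn ▸ finrank_submodule_lt_of_linearEquiv (k := k) E.symm) C rfl
    obtain ⟨g₂, h₂⟩ := he.exists_twist_equiv_of_isSimpleModule θ hθ hc (X := Z)
    let F : (C × Z) ≃ₗ[k] X := E.restrictScalars k
    refine ⟨F.symm.trans ((g₁.prodCongr g₂).trans F), fun r x => ?_⟩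
    obtain ⟨⟨c, z⟩, rfl⟩ := E.surjective x
    change E (g₁ (E.symm (θ r • E (c, z))).1, g₂ (E.symm (θ r • E (c, z))).2) =
      r • E (g₁ (E.symm (E (c, z))).1, g₂ (E.symm (E (c, z))).2)
    rw [← map_smul, ← map_smul, E.symm_apply_apply, E.symm_apply_apply]
    simp [h₁, h₂]

/-- A finite-dimensional representation of a separable algebra is isomorphic to its twist by an
automorphism which fixes the centre. -/
theorem IsSeparabilityIdempotent.exists_comp_equiv {e : Γ ⊗[k] Γ}
    (he : IsSeparabilityIdempotent e) (θ : Γ →ₐ[k] Γ) (hθ : Function.Surjective θ)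
    (hc : ∀ c : Γ, (∀ r, r * c = c * r) → θ c = c) [FiniteDimensional k X]
    (ρ : Γ →ₐ[k] End k X) :
    ∃ g : X ≃ₗ[k] X, ∀ (r : Γ) (x : X), g (ρ.comp θ r x) = ρ r (g x) :=
  he.exists_twist_equiv θ hθ hc _ (RepModule ρ) rfl

end Separability

/-! ### Identities for the counital maps -/

section CounitalMaps

open Coalgebra (comul counit)
open scoped Coalgebra
open TensorProduct

variable {k B : Type*} [Field k] [Ring B] [Algebra k B] [Coalgebra k B]

variable (k B) in
/-- The map `a ⊗ b ↦ ε(b) a`. -/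
noncomputable def counitRight : B ⊗[k] B →ₗ[k] B :=
  (TensorProduct.rid k B).toLinearMap ∘ₗ (counit (R := k)).lTensor B

variable (k B) in
/-- The map `a ⊗ b ↦ ε(a) b`. -/
noncomputable def counitLeft : B ⊗[k] B →ₗ[k] B :=
  (TensorProduct.lid k B).toLinearMap ∘ₗ (counit (R := k)).rTensor B

@[simp]
theorem counitRight_tmul (a b : B) :
    counitRight k B (a ⊗ₜ b) = counit (R := k) b • a := by
  simp [counitRight]

@[simp]
theorem counitLeft_tmul (a b : B) :
    counitLeft k B (a ⊗ₜ b) = counit (R := k) a • b := by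
  simp [counitLeft]

@[simp]
theorem counitRight_comul (b : B) : counitRight k B (comul b) = b := by
  simp [counitRight]

@[simp]
theorem counitLeft_comul (b : B) : counitLeft k B (comul b) = b := by
  simp [counitLeft]

variable {ι : Type*} (r : Coalgebra.Repr k (1 : B) ι)

theorem targetCounit_eq_sum (h : B) :
    targetCounit k B h = ∑ i ∈ r.index, counit (R := k) (r.left i * h) • r.right i := by
  change TensorProduct.lid k B ((counit ∘ₗ LinearMap.mulRight k h).rTensor B (comul 1)) = _
  rw [← r.eq]
  simp

theorem sourceCounit_eq_sum (h : B) :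
    sourceCounit k B h = ∑ i ∈ r.index, counit (R := k) (h * r.right i) • r.left i := by
  change TensorProduct.rid k B ((counit ∘ₗ LinearMap.mulLeft k h).lTensor B (comul 1)) = _
  rw [← r.eq]
  simp

theorem targetCounit_eq_counitLeft (h : B) :
    targetCounit k B h = counitLeft k B (comul 1 * (h ⊗ₜ 1)) := by
  rw [targetCounit_eq_sum (ℛ k 1), ← (ℛ k (1 : B)).eq]
  simp [Finset.sum_mul]

theorem sourceCounit_eq_counitRight (h : B) :
    sourceCounit k B h = counitRight k B (((1 : B) ⊗ₜ h) * comul 1) := by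
  rw [sourceCounit_eq_sum (ℛ k 1), ← (ℛ k (1 : B)).eq]
  simp [Finset.mul_sum]

theorem repr_one_sum_comul_tmul :
    ∑ i ∈ r.index, comul (R := k) (r.left i) ⊗ₜ[k] r.right i =
      (TensorProduct.assoc k B B B).symm
        (∑ i ∈ r.index, r.left i ⊗ₜ[k] comul (R := k) (r.right i)) := by
  have h := Coalgebra.coassoc_symm_apply (R := k) (1 : B)
  rw [← r.eq] at h
  simpa using h.symm

variable [IsWeakBialgebra k B]

theorem comul_one_mul_comul (b : B) :
    comul (R := k) (1 : B) * comul (R := k) b = comul (R := k) b := by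
  rw [← IsWeakBialgebra.comul_mul, one_mul]

theorem comul_mul_comul_one (b : B) :
    comul (R := k) b * comul (R := k) (1 : B) = comul (R := k) b := by
  rw [← IsWeakBialgebra.comul_mul, mul_one]

theorem repr_one_sum_tmul_comul :
    ∑ i ∈ r.index, r.left i ⊗ₜ[k] comul (R := k) (r.right i) =
      ∑ i ∈ r.index, ∑ j ∈ r.index,
        r.left i ⊗ₜ[k] ((r.right i * r.left j) ⊗ₜ[k] r.right j) := by
  have h := IsWeakBialgebra.comul_comul_one (k := k) (H := B)
  rw [← r.eq] at h
  simp only [map_sum, LinearMap.lTensor_tmul, tmul_sum, sum_tmul, TensorProduct.assoc_tmul,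
    Finset.sum_mul, Finset.mul_sum, Algebra.TensorProduct.tmul_mul_tmul, one_mul, mul_one] at h
  rw [h, Finset.sum_comm]

theorem repr_one_sum_tmul_comul' :
    ∑ i ∈ r.index, r.left i ⊗ₜ[k] comul (R := k) (r.right i) =
      ∑ i ∈ r.index, ∑ j ∈ r.index,
        r.left i ⊗ₜ[k] ((r.left j * r.right i) ⊗ₜ[k] r.right j) := by
  have h := IsWeakBialgebra.comul_comul_one' (k := k) (H := B)
  rw [← r.eq] at h
  simp only [map_sum, LinearMap.lTensor_tmul, tmul_sum, sum_tmul, TensorProduct.assoc_tmul,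
    Finset.sum_mul, Finset.mul_sum, Algebra.TensorProduct.tmul_mul_tmul, one_mul, mul_one] at h
  rw [h, Finset.sum_comm]

theorem counit_mul_eq_sum (f h : B) :
    counit (R := k) (f * h) =
      ∑ i ∈ r.index, counit (R := k) (f * r.left i) * counit (R := k) (r.right i * h) := by
  have := IsWeakBialgebra.counit_mul_mul (k := k) f 1 h
  rw [mul_one, ← r.eq] at this
  simpa using this

theorem counit_mul_eq_sum' (f h : B) :
    counit (R := k) (f * h) =
      ∑ i ∈ r.index, counit (R := k) (r.left i * h) * counit (R := k) (f * r.right i) := by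
  have := IsWeakBialgebra.counit_mul_mul' (k := k) f 1 h
  rw [mul_one, ← r.eq] at this
  simpa using this

/-- `ε(g ε_t(h)) = ε(g h)`. -/
theorem counit_mul_targetCounit (g h : B) :
    counit (R := k) (g * targetCounit k B h) = counit (R := k) (g * h) := by
  rw [counit_mul_eq_sum' (ℛ k 1) g h, targetCounit_eq_sum (ℛ k 1)]
  simp [Finset.mul_sum]

/-- `ε(ε_s(g) h) = ε(g h)`. -/
theorem counit_sourceCounit_mul (g h : B) :
    counit (R := k) (sourceCounit k B g * h) = counit (R := k) (g * h) := by
  rw [counit_mul_eq_sum' (ℛ k 1) g h, sourceCounit_eq_sum (ℛ k 1)]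
  simp [Finset.sum_mul, mul_comm]

/-- `ε_t(g ε_t(h)) = ε_t(g h)`. -/
theorem targetCounit_mul_targetCounit (g h : B) :
    targetCounit k B (g * targetCounit k B h) = targetCounit k B (g * h) := by
  simp only [targetCounit_eq_sum (ℛ k 1) (g * _), ← mul_assoc, counit_mul_targetCounit]

/-- `ε_s(ε_s(g) h) = ε_s(g h)`. -/
theorem sourceCounit_sourceCounit_mul (g h : B) :
    sourceCounit k B (sourceCounit k B g * h) = sourceCounit k B (g * h) := by
  simp only [sourceCounit_eq_sum (ℛ k 1) (_ * h), mul_assoc, counit_sourceCounit_mul]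

/-- `b₁ ⊗ ε_t(b₂) = 1₁ b ⊗ 1₂`. -/
theorem map_id_targetCounit_comul (b : B) :
    TensorProduct.map LinearMap.id (targetCounit k B) (comul b) =
      comul 1 * (b ⊗ₜ[k] (1 : B)) := by
  set r := ℛ k (1 : B)
  have h₁ (w : B ⊗[k] B) : TensorProduct.map LinearMap.id (targetCounit k B) w =
      ∑ i ∈ r.index, counitRight k B (((1 : B) ⊗ₜ r.left i) * w) ⊗ₜ[k] r.right i := by
    induction w with
    | zero => simp
    | tmul u v => simp [targetCounit_eq_sum r, tmul_sum, smul_tmul]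
    | add v w hv hw =>
      simp only [map_add, hv, hw, mul_add, add_tmul, Finset.sum_add_distrib]
  let F : (B ⊗[k] B) ⊗[k] B →ₗ[k] B ⊗[k] B :=
    TensorProduct.map (counitRight k B ∘ₗ LinearMap.mulRight k (comul (R := k) b)) LinearMap.id
  -- After inserting Δ(b) = Δ(1)Δ(b), the weak unit axiom assembles the two copies of Δ(1) into
  -- Δ(1₁)Δ(b) ⊗ 1₂ = Δ(1₁b) ⊗ 1₂, and the counit collapses the middle leg.
  have h₂ := congrArg F (repr_one_sum_comul_tmul r)
  rw [(repr_one_sum_tmul_comul' r)] at h₂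
  simp only [map_sum, F, TensorProduct.map_tmul, LinearMap.comp_apply, LinearMap.mulRight_apply,
    LinearMap.id_apply, TensorProduct.assoc_symm_tmul, ← IsWeakBialgebra.comul_mul,
    counitRight_comul] at h₂
  rw [h₁, ← comul_one_mul_comul b, ← r.eq, Finset.sum_mul (a := b ⊗ₜ[k] (1 : B))]
  simp only [Algebra.TensorProduct.tmul_mul_tmul, mul_one]
  rw [h₂, Finset.sum_comm]
  simp only [← mul_assoc, Finset.mul_sum, Finset.sum_mul, map_sum, sum_tmul,
    Algebra.TensorProduct.tmul_mul_tmul, one_mul]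

/-- `ε_s(b₁) ⊗ b₂ = 1₁ ⊗ b 1₂`. -/
theorem map_sourceCounit_id_comul (b : B) :
    TensorProduct.map (sourceCounit k B) LinearMap.id (comul b) =
      ((1 : B) ⊗ₜ[k] b) * comul 1 := by
  set r := ℛ k (1 : B)
  have h₁ (w : B ⊗[k] B) : TensorProduct.map (sourceCounit k B) LinearMap.id w =
      ∑ i ∈ r.index, r.left i ⊗ₜ[k] counitLeft k B (w * (r.right i ⊗ₜ (1 : B))) := by
    induction w with
    | zero => simp
    | tmul u v => simp [sourceCounit_eq_sum r, sum_tmul, smul_tmul]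
    | add v w hv hw =>
      simp only [map_add, hv, hw, add_mul, tmul_add, Finset.sum_add_distrib]
  let F : B ⊗[k] (B ⊗[k] B) →ₗ[k] B ⊗[k] B :=
    TensorProduct.map LinearMap.id (counitLeft k B ∘ₗ LinearMap.mulLeft k (comul (R := k) b))
  have h₂ := congrArg F (repr_one_sum_tmul_comul' r)
  simp only [map_sum, F, TensorProduct.map_tmul, LinearMap.comp_apply, LinearMap.mulLeft_apply,
    LinearMap.id_apply, ← IsWeakBialgebra.comul_mul, counitLeft_comul] at h₂
  rw [h₁, ← comul_mul_comul_one b, ← r.eq, Finset.mul_sum (a := (1 : B) ⊗ₜ[k] b)]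
  simp only [Algebra.TensorProduct.tmul_mul_tmul, one_mul]
  rw [h₂]
  simp only [mul_assoc, Finset.mul_sum, Finset.sum_mul, map_sum, tmul_sum,
    Algebra.TensorProduct.tmul_mul_tmul, mul_one]

/-- `b₁ ε(b₂ y) = b 1₁ ε(1₂ y)`. -/
theorem counitRight_comul_mul (b y : B) :
    counitRight k B (comul b * ((1 : B) ⊗ₜ[k] y)) =
      b * counitRight k B (comul 1 * ((1 : B) ⊗ₜ[k] y)) := by
  set r := ℛ k (1 : B)
  let F : (B ⊗[k] B) ⊗[k] B →ₗ[k] B := (TensorProduct.rid k B).toLinearMap ∘ₗ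
    TensorProduct.map (counitRight k B ∘ₗ LinearMap.mulLeft k (comul (R := k) b))
      (counit ∘ₗ LinearMap.mulRight k y)
  -- The weak counit axiom splits ε(vqy) as ε(vq₁)ε(q₂y). With Δ(b) = Δ(b)Δ(1) this yields
  -- b₁1₁ε(b₂1₂)ε(1₃y), and the first counit collapses Δ(b1₁) to b1₁.
  have h₁ (w : B ⊗[k] B) (p q : B) : counitRight k B (w * (p ⊗ₜ (q * y))) =
      TensorProduct.rid k B (TensorProduct.map
        (counitRight k B ∘ₗ LinearMap.mulLeft k w) (counit ∘ₗ LinearMap.mulRight k y)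
        ((TensorProduct.assoc k B B B).symm (p ⊗ₜ comul q))) := by
    induction w with
    | zero =>
      rw [show LinearMap.mulLeft k (0 : B ⊗[k] B) = 0 by ext; simp]
      simp
    | tmul u v =>
      have h₂ (z : B ⊗[k] B) : TensorProduct.rid k B (TensorProduct.map
          (counitRight k B ∘ₗ LinearMap.mulLeft k (u ⊗ₜ[k] v)) (counit ∘ₗ LinearMap.mulRight k y)
          ((TensorProduct.assoc k B B B).symm (p ⊗ₜ z))) =
          LinearMap.mul' k k (TensorProduct.map (counit ∘ₗ LinearMap.mulLeft k v)
            (counit ∘ₗ LinearMap.mulRight k y) z) • (u * p) := by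
        induction z with
        | zero => simp
        | tmul a c => simp [smul_smul, mul_comm]
        | add z w hz hw => simp only [tmul_add, map_add, hz, hw, add_smul]
      rw [h₂, ← IsWeakBialgebra.counit_mul_mul, Algebra.TensorProduct.tmul_mul_tmul,
        counitRight_tmul, mul_assoc]
    | add v w hv hw =>
      rw [show LinearMap.mulLeft k (v + w) = LinearMap.mulLeft k v + LinearMap.mulLeft k w by
        ext; simp [add_mul]]
      simp only [LinearMap.comp_add, TensorProduct.map_add_left, map_add, LinearMap.add_apply,
        add_mul, hv, hw]
  have h₂ := congrArg F (repr_one_sum_comul_tmul r)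
  simp only [map_sum, F, TensorProduct.map_tmul, LinearMap.comp_apply, LinearMap.mulLeft_apply,
    LinearMap.mulRight_apply, LinearEquiv.coe_coe,
    ← IsWeakBialgebra.comul_mul, counitRight_comul, TensorProduct.rid_tmul] at h₂
  rw [← comul_mul_comul_one b, ← r.eq]
  simp only [Finset.mul_sum, Finset.sum_mul, map_sum, mul_assoc,
    Algebra.TensorProduct.tmul_mul_tmul, mul_one, counitRight_tmul]
  simp only [h₁, mul_smul_comm, h₂]

/-- `b₁ ⊗ ε_s(b₂) = b 1₁ ⊗ ε_s(1₂)`. -/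
theorem map_id_sourceCounit_comul (b : B) :
    TensorProduct.map LinearMap.id (sourceCounit k B) (comul b) =
      (b ⊗ₜ[k] (1 : B)) * TensorProduct.map LinearMap.id (sourceCounit k B) (comul 1) := by
  set r := ℛ k (1 : B)
  have h₁ (w : B ⊗[k] B) : TensorProduct.map LinearMap.id (sourceCounit k B) w =
      ∑ i ∈ r.index, counitRight k B (w * ((1 : B) ⊗ₜ r.right i)) ⊗ₜ[k] r.left i := by
    induction w with
    | zero => simp
    | tmul u v => simp [sourceCounit_eq_sum r, tmul_sum, smul_tmul]
    | add v w hv hw =>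
      simp only [map_add, hv, hw, add_mul, add_tmul, Finset.sum_add_distrib]
  rw [h₁, h₁, Finset.mul_sum]
  refine Finset.sum_congr rfl fun i _ => ?_
  rw [counitRight_comul_mul, Algebra.TensorProduct.tmul_mul_tmul, one_mul]

/-- `ε_s(1₂) ⊗ ε_t(1₁) = 1₁ ⊗ 1₂`. -/
theorem map_sourceCounit_targetCounit_comm_comul_one :
    TensorProduct.map (sourceCounit k B) (targetCounit k B)
      (TensorProduct.comm k B B (comul 1)) = comul 1 := by
  set r := ℛ k (1 : B)
  have h := congrArg (TensorProduct.map LinearMap.id (counitLeft k B))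
    (repr_one_sum_tmul_comul' r)
  simp only [map_sum, TensorProduct.map_tmul, LinearMap.id_apply, counitLeft_comul,
    counitLeft_tmul, r.eq] at h
  refine Eq.trans ?_ h.symm
  -- Both sides are compared as sums over three copies of Δ(1): applying ε to the middle leg of 1₁ ⊗
  -- 1₂ ⊗ 1₃ leaves factors ε(1''₁1'₂), which the weak counit axiom splits through a third copy.
  have h₁ := fun i j => counit_mul_eq_sum r (r.left j) (r.right i)
  rw [← r.eq]
  simp only [map_sum, TensorProduct.comm_tmul, TensorProduct.map_tmul, sourceCounit_eq_sum r,
    targetCounit_eq_sum r, sum_tmul, tmul_sum, h₁, Finset.sum_smul,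
    Finset.smul_sum, tmul_smul, ← smul_tmul', smul_smul]
  conv_rhs =>
    enter [2, x]
    rw [Finset.sum_comm]
  conv_rhs => rw [Finset.sum_comm]
  refine Finset.sum_congr rfl fun i _ => ?_
  rw [Finset.sum_comm]

end CounitalMaps

/-! ### The convolution product -/

section Convolution

open Coalgebra (comul counit)
open scoped Coalgebra
open TensorProduct

variable {k C D A A' : Type*} [Field k] [AddCommGroup C] [Module k C] [Coalgebra k C]
  [AddCommGroup D] [Module k D] [Coalgebra k D] [Ring A] [Algebra k A] [Ring A'] [Algebra k A']

/-- The convolution product `c ↦ f(c₁) g(c₂)` of two linear maps. -/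
noncomputable def convolution (f g : C →ₗ[k] A) : C →ₗ[k] A :=
  LinearMap.mul' k A ∘ₗ TensorProduct.map f g ∘ₗ comul

theorem convolution_apply (f g : C →ₗ[k] A) (c : C) :
    convolution f g c = LinearMap.mul' k A (TensorProduct.map f g (comul c)) := rfl

theorem convolution_assoc (f g h : C →ₗ[k] A) :
    convolution (convolution f g) h = convolution f (convolution g h) :=
  congrArg WithConv.ofConv
    (mul_assoc (WithConv.toConv f) (WithConv.toConv g) (WithConv.toConv h))

theorem algHom_comp_convolution (φ : A →ₐ[k] A') (f g : C →ₗ[k] A) :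
    φ.toLinearMap ∘ₗ convolution f g = convolution (φ.toLinearMap ∘ₗ f) (φ.toLinearMap ∘ₗ g) := by
  ext c
  simp only [LinearMap.comp_apply, convolution_apply]
  induction comul (R := k) c with
  | zero => simp
  | tmul u v => simp
  | add v w hv hw => simp only [map_add, hv, hw]

theorem convolution_comp (π : D →ₗ[k] C)
    (hπ : ∀ d, comul (R := k) (π d) = TensorProduct.map π π (comul (R := k) d))
    (f g : C →ₗ[k] A) :
    convolution f g ∘ₗ π = convolution (f ∘ₗ π) (g ∘ₗ π) := by
  ext d
  simp only [LinearMap.comp_apply, convolution_apply, hπ, TensorProduct.map_comp]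

end Convolution

/-! ### Galois maps and their ranks -/

section GaloisMap

open Coalgebra (comul counit)
open scoped Coalgebra
open TensorProduct

variable {k B : Type*} [Field k] [Ring B] [Algebra k B] [Coalgebra k B]

/-- The map `b ⊗ c ↦ b₁ ⊗ a(b₂) c`. -/
noncomputable def galoisMap (a : B →ₗ[k] B) : B ⊗[k] B →ₗ[k] B ⊗[k] B :=
  (LinearMap.mul' k B ∘ₗ a.rTensor B).lTensor B ∘ₗ
    (TensorProduct.assoc k B B B).toLinearMap ∘ₗ (comul (R := k)).rTensor B

theorem galoisMap_tmul (a : B →ₗ[k] B) (b c : B) :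
    galoisMap a (b ⊗ₜ c) =
      TensorProduct.map LinearMap.id a (comul b) * ((1 : B) ⊗ₜ[k] c) := by
  simp only [galoisMap, LinearMap.comp_apply, LinearMap.rTensor_tmul, LinearEquiv.coe_coe]
  induction comul (R := k) b with
  | zero => simp
  | tmul u v => simp
  | add v w hv hw => simp only [map_add, add_tmul, add_mul, hv, hw]

theorem galoisMap_mul (a : B →ₗ[k] B) (w : B ⊗[k] B) (c : B) :
    galoisMap a (w * ((1 : B) ⊗ₜ[k] c)) = galoisMap a w * ((1 : B) ⊗ₜ[k] c) := by
  induction w with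
  | zero => simp
  | tmul u v => simp [galoisMap_tmul, mul_assoc]
  | add v w hv hw => simp only [map_add, add_mul, hv, hw]

/-- Coassociativity turns the Galois map into a convolution on the second leg, so identities between
Galois maps reduce to identities in the convolution algebra. -/
theorem galoisMap_map {H : Type*} [AddCommGroup H] [Module k H] [Coalgebra k H]
    (π : H →ₗ[k] B) (hπ : ∀ d, comul (R := k) (π d) = TensorProduct.map π π (comul (R := k) d))
    (a : B →ₗ[k] B) (a' : H →ₗ[k] B) (h : H) :
    galoisMap a (TensorProduct.map π a' (comul h)) =
      TensorProduct.map π (convolution (a ∘ₗ π) a') (comul h) := by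
  have h₁ (w : H ⊗[k] H) : galoisMap a (TensorProduct.map π a' w) =
      TensorProduct.map π (LinearMap.mul' k B ∘ₗ TensorProduct.map (a ∘ₗ π) a')
        (TensorProduct.assoc k H H H ((comul (R := k)).rTensor H w)) := by
    induction w with
    | zero => simp
    | tmul u v =>
      rw [TensorProduct.map_tmul, galoisMap_tmul, hπ, LinearMap.rTensor_tmul]
      induction comul (R := k) u with
      | zero => simp
      | tmul u v => simp
      | add v w hv hw => simp only [map_add, add_tmul, add_mul, hv, hw]
    | add v w hv hw => simp only [map_add, hv, hw]
  rw [h₁, Coalgebra.coassoc_apply]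
  induction comul (R := k) h with
  | zero => simp
  | tmul u v => simp [convolution_apply]
  | add v w hv hw => simp only [map_add, hv, hw]

theorem mul'_map_id_sourceCounit (w : B ⊗[k] B) :
    LinearMap.mul' k B (TensorProduct.map LinearMap.id (sourceCounit k B) w) =
      counitRight k B (w * comul 1) := by
  rw [← (ℛ k (1 : B)).eq]
  induction w with
  | zero => simp
  | tmul u v => simp [sourceCounit_eq_sum (ℛ k 1), Finset.mul_sum]
  | add v w hv hw => simp only [map_add, add_mul, hv, hw]

theorem mul'_map_targetCounit_id (w : B ⊗[k] B) :
    LinearMap.mul' k B (TensorProduct.map (targetCounit k B) LinearMap.id w) =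
      counitLeft k B (comul 1 * w) := by
  rw [← (ℛ k (1 : B)).eq]
  induction w with
  | zero => simp
  | tmul u v => simp [targetCounit_eq_sum (ℛ k 1), Finset.sum_mul]
  | add v w hv hw => simp only [map_add, mul_add, hv, hw]

variable [IsWeakBialgebra k B]

theorem convolution_id_sourceCounit :
    convolution LinearMap.id (sourceCounit k B) = LinearMap.id := by
  ext b
  rw [convolution_apply, mul'_map_id_sourceCounit, comul_mul_comul_one, counitRight_comul,
    LinearMap.id_apply]

theorem convolution_targetCounit_id :
    convolution (targetCounit k B) LinearMap.id = LinearMap.id := by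
  ext b
  rw [convolution_apply, mul'_map_targetCounit_id, comul_one_mul_comul, counitLeft_comul,
    LinearMap.id_apply]

theorem map_sourceCounit_id_comul_one :
    TensorProduct.map (sourceCounit k B) LinearMap.id (comul (1 : B)) = comul 1 := by
  rw [map_sourceCounit_id_comul, ← Algebra.TensorProduct.one_def, one_mul]

theorem map_id_targetCounit_comul_one :
    TensorProduct.map LinearMap.id (targetCounit k B) (comul (1 : B)) = comul 1 := by
  rw [map_id_targetCounit_comul, ← Algebra.TensorProduct.one_def, mul_one]

/-- This is id * ε_s = id read on the second leg. -/
theorem galoisMap_id_comp_galoisMap_sourceCounit :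
    galoisMap (LinearMap.id (R := k) (M := B)) ∘ₗ galoisMap (sourceCounit k B) =
      galoisMap LinearMap.id := by
  refine TensorProduct.ext' fun b c => ?_
  rw [LinearMap.comp_apply, galoisMap_tmul, galoisMap_mul,
    galoisMap_map (LinearMap.id (R := k) (M := B)) (fun d => by simp), LinearMap.comp_id,
    convolution_id_sourceCounit, galoisMap_tmul]

/-- The first leg of Δ(1) already lies in B_s, so ε_s may be inserted there. In this form the
equivariance of an isomorphism as in (2) can be applied to it. -/
theorem comul_one_eq_map_comm :
    comul (1 : B) = TensorProduct.map (sourceCounit k B)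
      (targetCounit k B ∘ₗ sourceCounit k B) (TensorProduct.comm k B B (comul 1)) := by
  conv_lhs => rw [← map_sourceCounit_targetCounit_comm_comul_one,
    ← map_sourceCounit_id_comul_one]
  generalize comul (R := k) (1 : B) = w
  induction w with
  | zero => simp
  | tmul u v => simp
  | add v w hv hw => simp only [map_add, hv, hw]

/-- An isomorphism of the source and target modules intertwines `b ⊗ c ↦ b₁ ⊗ ε_s(b₂) c` and
`b ⊗ c ↦ b₁ ⊗ ε_t(b₂) c`. -/
theorem comm_map_galoisMap_sourceCounit (f : B ≃ₗ[k] B)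
    (hf : ∀ y ∈ sourceSubspace k B, ∀ b, f (b * y) = targetCounit k B y * f b) (w : B ⊗[k] B) :
    TensorProduct.comm k B B (f.rTensor B (galoisMap (sourceCounit k B) w)) =
      galoisMap (targetCounit k B) (TensorProduct.comm k B B (f.rTensor B w)) := by
  induction w with
  | zero => simp
  | tmul b c =>
    -- Since 1₁ lies in B_s, f(b1₁) = ε_t(1₁)f(b). After the flip, ε_s(1₂) ⊗ ε_t(1₁) is again Δ(1).
    have key (w : B ⊗[k] B) : TensorProduct.comm k B B (f.rTensor B ((b ⊗ₜ[k] (1 : B)) *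
        (TensorProduct.map LinearMap.id (sourceCounit k B)
          (TensorProduct.map (sourceCounit k B) LinearMap.id w)) * ((1 : B) ⊗ₜ[k] c))) =
        TensorProduct.map (sourceCounit k B) (targetCounit k B ∘ₗ sourceCounit k B)
          (TensorProduct.comm k B B w) * (c ⊗ₜ[k] (1 : B)) * ((1 : B) ⊗ₜ[k] f b) := by
      induction w with
      | zero => simp
      | tmul u v => simp [hf _ (LinearMap.mem_range_self (sourceCounit k B) u)]
      | add v w hv hw => simp only [map_add, mul_add, add_mul, hv, hw]
    rw [LinearEquiv.rTensor_tmul, TensorProduct.comm_tmul, galoisMap_tmul, galoisMap_tmul,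
      map_id_sourceCounit_comul, map_id_targetCounit_comul,
      ← map_sourceCounit_id_comul_one, key, ← comul_one_eq_map_comm,
      map_sourceCounit_id_comul_one]
  | add v w hv hw => simp only [map_add, hv, hw]

/-- One inclusion of kernels is formal. For equality, rank β_id ≥ rank β_{ε_t} = rank β_{ε_s}, the
last two maps being conjugate by b ⊗ c ↦ c ⊗ f(b). -/
theorem ker_galoisMap_id_eq [FiniteDimensional k B] (h : SourceTargetModulesIsomorphic k B)
    (hr : (galoisMap (targetCounit k B)).range ≤
      (galoisMap (LinearMap.id (R := k) (M := B))).range) :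
    (galoisMap (LinearMap.id (R := k) (M := B))).ker = (galoisMap (sourceCounit k B)).ker := by
  obtain ⟨f, hf⟩ := h
  symm
  apply Submodule.eq_of_le_of_finrank_le
  · rw [← galoisMap_id_comp_galoisMap_sourceCounit]
    exact LinearMap.ker_le_ker_comp _ _
  have h₁ := (galoisMap (LinearMap.id (R := k) (M := B))).finrank_range_add_finrank_ker
  have h₂ := (galoisMap (sourceCounit k B)).finrank_range_add_finrank_ker
  have h₃ := Submodule.finrank_mono hr
  let Φ : B ⊗[k] B ≃ₗ[k] B ⊗[k] B := (f.rTensor B).trans (TensorProduct.comm k B B)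
  have h₄ : Φ.toLinearMap ∘ₗ galoisMap (sourceCounit k B) =
      galoisMap (targetCounit k B) ∘ₗ Φ.toLinearMap :=
    LinearMap.ext (comm_map_galoisMap_sourceCounit f hf)
  have h₅ : (galoisMap (targetCounit k B)).range =
      (galoisMap (sourceCounit k B)).range.map Φ.toLinearMap := by
    rw [← LinearMap.range_comp, h₄, LinearMap.range_comp_of_range_eq_top _ Φ.range]
  have h₆ : Module.finrank k (galoisMap (targetCounit k B)).range =
      Module.finrank k (galoisMap (sourceCounit k B)).range := by
    rw [h₅]
    exact LinearEquiv.finrank_map_eq Φ _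
  omega

end GaloisMap

/-! ### Descent of the antipode to the quotient -/

section Descent

open Coalgebra (comul counit)
open TensorProduct

variable {k H B : Type*} [Field k] [Ring H] [Algebra k H] [Coalgebra k H]
  [Ring B] [Algebra k B] [Coalgebra k B]

theorem IsWeakAntipode.convolution_left {S : H →ₗ[k] H} (hS : IsWeakAntipode k H S) :
    convolution S LinearMap.id = sourceCounit k H := LinearMap.ext hS.mul_left

theorem IsWeakAntipode.convolution_right {S : H →ₗ[k] H} (hS : IsWeakAntipode k H S) :
    convolution LinearMap.id S = targetCounit k H := LinearMap.ext hS.mul_right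

theorem IsWeakAntipode.convolution_targetCounit {S : H →ₗ[k] H} (hS : IsWeakAntipode k H S) :
    convolution S (targetCounit k H) = S := by
  rw [← hS.convolution_right]
  exact LinearMap.ext hS.mul_mul

theorem IsWeakAntipode.convolution_sourceCounit {S : H →ₗ[k] H} (hS : IsWeakAntipode k H S) :
    convolution (sourceCounit k H) S = S := by
  rw [← hS.convolution_left, convolution_assoc, hS.convolution_right, hS.convolution_targetCounit]

variable (π : H →ₐ[k] B)
  (hπ : ∀ h, comul (R := k) (π h) = TensorProduct.map π.toLinearMap π.toLinearMap (comul h))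
  (hπ' : ∀ h, counit (R := k) (π h) = counit (R := k) h)

include hπ hπ'

theorem sourceCounit_comp_algHom :
    sourceCounit k B ∘ₗ π.toLinearMap = π.toLinearMap ∘ₗ sourceCounit k H := by
  ext h
  have h₁ : comul (R := k) (1 : B) = _ := map_one π ▸ hπ 1
  simp only [LinearMap.comp_apply, sourceCounit_eq_counitRight, h₁]
  induction comul (R := k) (1 : H) with
  | zero => simp
  | tmul u v => simp [← map_mul, hπ']
  | add v w hv hw => simp only [map_add, mul_add, hv, hw]

theorem targetCounit_comp_algHom :
    targetCounit k B ∘ₗ π.toLinearMap = π.toLinearMap ∘ₗ targetCounit k H := by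
  ext h
  have h₁ : comul (R := k) (1 : B) = _ := map_one π ▸ hπ 1
  simp only [LinearMap.comp_apply, targetCounit_eq_counitLeft, h₁]
  induction comul (R := k) (1 : H) with
  | zero => simp
  | tmul u v => simp [← map_mul, hπ']
  | add v w hv hw => simp only [map_add, add_mul, hv, hw]

variable {S : H →ₗ[k] H} (hS : IsWeakAntipode k H S) (hsurj : Function.Surjective π)

include hS

/-- On the second leg this is id * S = ε_t. It provides preimages under β_id for the image of
β_{ε_t}. -/
theorem galoisMap_id_map_antipode [IsWeakBialgebra k B] (h : H) (c : B) :
    galoisMap LinearMap.id (TensorProduct.map π.toLinearMap (π.toLinearMap ∘ₗ S) (comul h) *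
      ((1 : B) ⊗ₜ[k] c)) = galoisMap (targetCounit k B) (π h ⊗ₜ[k] c) := by
  rw [galoisMap_mul, galoisMap_map π.toLinearMap hπ, LinearMap.id_comp,
    ← LinearMap.comp_id π.toLinearMap, LinearMap.comp_assoc, LinearMap.id_comp,
    ← algHom_comp_convolution, hS.convolution_right,
    ← targetCounit_comp_algHom π hπ hπ', galoisMap_tmul, hπ,
      ← LinearMap.comp_apply (g := TensorProduct.map π.toLinearMap π.toLinearMap),
      ← TensorProduct.map_comp]
  rfl

theorem galoisMap_sourceCounit_map_antipode (h : H) :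
    galoisMap (sourceCounit k B) (TensorProduct.map π.toLinearMap (π.toLinearMap ∘ₗ S) (comul h)) =
      TensorProduct.map π.toLinearMap (π.toLinearMap ∘ₗ S) (comul h) := by
  rw [galoisMap_map π.toLinearMap hπ, sourceCounit_comp_algHom π hπ hπ',
    ← algHom_comp_convolution, hS.convolution_sourceCounit]

include hsurj in
theorem range_galoisMap_targetCounit_le [IsWeakBialgebra k B] :
    (galoisMap (targetCounit k B)).range ≤
      (galoisMap (LinearMap.id (R := k) (M := B))).range := by
  rintro _ ⟨w, rfl⟩
  induction w with
  | zero => simp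
  | tmul b c =>
    obtain ⟨h, rfl⟩ := hsurj b
    exact ⟨_, galoisMap_id_map_antipode π hπ hπ' hS h c⟩
  | add v w hv hw =>
    rw [map_add]
    exact Submodule.add_mem _ hv hw

include hsurj in
-- The element π(h₁) ⊗ π(S(h₂)) lies in ker β_id = ker β_{ε_s}, while ε_s * S = S makes β_{ε_s} fix
-- it. Hence it vanishes, and ε on the first leg recovers π(S(h)).
theorem map_antipode_eq_zero [IsWeakBialgebra k B] [FiniteDimensional k B]
    (hiso : SourceTargetModulesIsomorphic k B) (h : H) (hh : π h = 0) : π (S h) = 0 := by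
  set w := TensorProduct.map π.toLinearMap (π.toLinearMap ∘ₗ S) (comul (R := k) h) with hw
  have h₁ : w ∈ (galoisMap (LinearMap.id (R := k) (M := B))).ker := by
    have := galoisMap_id_map_antipode π hπ hπ' hS h 1
    rw [← Algebra.TensorProduct.one_def, mul_one] at this
    rw [LinearMap.mem_ker, this, hh, zero_tmul, map_zero]
  rw [ker_galoisMap_id_eq hiso (range_galoisMap_targetCounit_le π hπ hπ' hS hsurj),
    LinearMap.mem_ker, galoisMap_sourceCounit_map_antipode π hπ hπ' hS] at h₁
  have h₂ (v : H ⊗[k] H) : counitLeft k B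
      (TensorProduct.map π.toLinearMap (π.toLinearMap ∘ₗ S) v) = π (S (counitLeft k H v)) := by
    induction v with
    | zero => simp
    | tmul u v => simp [hπ']
    | add v w hv hw => simp only [map_add, hv, hw]
  have h₃ := h₂ (comul h)
  rw [h₁, counitLeft_comul, map_zero] at h₃
  exact h₃.symm

include hsurj in
/-- A finite-dimensional quotient weak bialgebra with isomorphic source and target modules
inherits an antipode. -/
theorem exists_isWeakAntipode_of_surjective [IsWeakBialgebra k B] [FiniteDimensional k B]
    (hiso : SourceTargetModulesIsomorphic k B) : ∃ S' : B →ₗ[k] B, IsWeakAntipode k B S' := by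
  obtain ⟨s, hs⟩ := π.toLinearMap.exists_rightInverse_of_surjective
    (LinearMap.range_eq_top.2 hsurj)
  have hs' : ∀ b, π (s b) = b := LinearMap.congr_fun hs
  have hsurj' : Function.Surjective π.toLinearMap := hsurj
  -- Any linear section s serves: two lifts of the same element differ by an element of ker π, on
  -- which π ∘ S vanishes.
  let S' : B →ₗ[k] B := π.toLinearMap ∘ₗ S ∘ₗ s
  have hS' : S' ∘ₗ π.toLinearMap = π.toLinearMap ∘ₗ S := by
    ext h
    change π (S (s (π h))) = π (S h)
    rw [← sub_eq_zero, ← map_sub, ← map_sub]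
    exact map_antipode_eq_zero π hπ hπ' hS hsurj hiso _ (by rw [map_sub, hs', sub_self])
  have hl : convolution S' LinearMap.id = sourceCounit k B := by
    rw [← LinearMap.cancel_right hsurj', convolution_comp _ hπ, hS',
      sourceCounit_comp_algHom π hπ hπ', ← hS.convolution_left, algHom_comp_convolution]
    rfl
  have hr : convolution LinearMap.id S' = targetCounit k B := by
    rw [← LinearMap.cancel_right hsurj', convolution_comp _ hπ, hS',
      targetCounit_comp_algHom π hπ hπ', ← hS.convolution_right, algHom_comp_convolution]
    rfl
  have hm : convolution S' (convolution LinearMap.id S') = S' := by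
    rw [← LinearMap.cancel_right hsurj', convolution_comp _ hπ, hS', hr,
      targetCounit_comp_algHom π hπ hπ', ← algHom_comp_convolution, hS.convolution_targetCounit]
  exact ⟨S', LinearMap.congr_fun hl, LinearMap.congr_fun hr, LinearMap.congr_fun hm⟩

end Descent

/-! ### The counital subalgebras and the separability of B_s -/

section CounitalSubalgebras

open Coalgebra (comul counit)
open scoped Coalgebra
open TensorProduct

variable {k B : Type*} [Field k] [Ring B] [Algebra k B] [Coalgebra k B]

@[simp]
theorem sourceCounit_one : sourceCounit k B 1 = 1 := by
  rw [sourceCounit_eq_counitRight, ← Algebra.TensorProduct.one_def, one_mul, counitRight_comul]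

@[simp]
theorem targetCounit_one : targetCounit k B 1 = 1 := by
  rw [targetCounit_eq_counitLeft, ← Algebra.TensorProduct.one_def, mul_one, counitLeft_comul]

variable [IsWeakBialgebra k B]

/-- Apply ε(h ·) to the last leg of 1₁ ⊗ 1₂ ⊗ 1₃ = 1₁ ⊗ 1₂1'₁ ⊗ 1'₂. The other order of the factors
gives the primed version, and the mirror argument treats ε_t. -/
theorem comul_sourceCounit (h : B) :
    comul (R := k) (sourceCounit k B h) = comul 1 * ((1 : B) ⊗ₜ[k] sourceCounit k B h) := by
  set r := ℛ k (1 : B)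
  have h₁ := congrArg (TensorProduct.rid k (B ⊗[k] B) ∘
    (counit ∘ₗ LinearMap.mulLeft k h).lTensor (B ⊗[k] B)) (repr_one_sum_comul_tmul r)
  rw [repr_one_sum_tmul_comul] at h₁
  simp only [Function.comp_apply, map_sum, LinearMap.lTensor_tmul, TensorProduct.rid_tmul,
    TensorProduct.assoc_symm_tmul, LinearMap.comp_apply, LinearMap.mulLeft_apply] at h₁
  rw [← r.eq]
  simp only [sourceCounit_eq_sum r, map_sum, map_smul, h₁, Finset.sum_mul, tmul_sum,
    tmul_smul, Finset.mul_sum, mul_smul_comm, Algebra.TensorProduct.tmul_mul_tmul, mul_one,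
    Finset.smul_sum]
  rw [Finset.sum_comm]

theorem comul_sourceCounit' (h : B) :
    comul (R := k) (sourceCounit k B h) = ((1 : B) ⊗ₜ[k] sourceCounit k B h) * comul 1 := by
  set r := ℛ k (1 : B)
  have h₁ := congrArg (TensorProduct.rid k (B ⊗[k] B) ∘
    (counit ∘ₗ LinearMap.mulLeft k h).lTensor (B ⊗[k] B)) (repr_one_sum_comul_tmul r)
  rw [repr_one_sum_tmul_comul'] at h₁
  simp only [Function.comp_apply, map_sum, LinearMap.lTensor_tmul, TensorProduct.rid_tmul,
    TensorProduct.assoc_symm_tmul, LinearMap.comp_apply, LinearMap.mulLeft_apply] at h₁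
  rw [← r.eq]
  simp only [sourceCounit_eq_sum r, map_sum, map_smul, h₁, Finset.sum_mul, tmul_sum,
    tmul_smul, Finset.mul_sum, smul_mul_assoc, Algebra.TensorProduct.tmul_mul_tmul, one_mul]

theorem comul_targetCounit (h : B) :
    comul (R := k) (targetCounit k B h) = (targetCounit k B h ⊗ₜ[k] (1 : B)) * comul 1 := by
  set r := ℛ k (1 : B)
  have h₁ := congrArg (TensorProduct.lid k (B ⊗[k] B) ∘
    (counit ∘ₗ LinearMap.mulRight k h).rTensor (B ⊗[k] B)) (repr_one_sum_tmul_comul r)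
  simp only [Function.comp_apply, map_sum, LinearMap.rTensor_tmul, TensorProduct.lid_tmul,
    LinearMap.comp_apply, LinearMap.mulRight_apply] at h₁
  rw [← r.eq]
  simp only [targetCounit_eq_sum r, map_sum, map_smul, h₁, Finset.mul_sum, sum_tmul,
    ← smul_tmul', Finset.sum_mul, smul_mul_assoc, Algebra.TensorProduct.tmul_mul_tmul, one_mul]
  rw [Finset.sum_comm]

theorem comul_targetCounit' (h : B) :
    comul (R := k) (targetCounit k B h) = comul 1 * (targetCounit k B h ⊗ₜ[k] (1 : B)) := by
  set r := ℛ k (1 : B)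
  have h₁ := congrArg (TensorProduct.lid k (B ⊗[k] B) ∘
    (counit ∘ₗ LinearMap.mulRight k h).rTensor (B ⊗[k] B)) (repr_one_sum_tmul_comul' r)
  simp only [Function.comp_apply, map_sum, LinearMap.rTensor_tmul, TensorProduct.lid_tmul,
    LinearMap.comp_apply, LinearMap.mulRight_apply] at h₁
  rw [← r.eq]
  simp only [targetCounit_eq_sum r, map_sum, map_smul, h₁, Finset.mul_sum, sum_tmul,
    ← smul_tmul', Finset.sum_mul, mul_smul_comm, Algebra.TensorProduct.tmul_mul_tmul, mul_one,
    Finset.smul_sum]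

theorem comul_mul_sourceCounit (b h : B) :
    comul (R := k) (b * sourceCounit k B h) =
      comul b * ((1 : B) ⊗ₜ[k] sourceCounit k B h) := by
  rw [IsWeakBialgebra.comul_mul, comul_sourceCounit, ← mul_assoc, comul_mul_comul_one]

theorem comul_sourceCounit_mul (b h : B) :
    comul (R := k) (sourceCounit k B h * b) =
      ((1 : B) ⊗ₜ[k] sourceCounit k B h) * comul b := by
  rw [IsWeakBialgebra.comul_mul, comul_sourceCounit', mul_assoc, comul_one_mul_comul]

theorem comul_mul_targetCounit (b h : B) :
    comul (R := k) (b * targetCounit k B h) =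
      comul b * (targetCounit k B h ⊗ₜ[k] (1 : B)) := by
  rw [IsWeakBialgebra.comul_mul, comul_targetCounit', ← mul_assoc, comul_mul_comul_one]

theorem comul_targetCounit_mul (b h : B) :
    comul (R := k) (targetCounit k B h * b) =
      (targetCounit k B h ⊗ₜ[k] (1 : B)) * comul b := by
  rw [IsWeakBialgebra.comul_mul, comul_targetCounit, mul_assoc, comul_one_mul_comul]

/-- The source and the target counital subalgebra commute. -/
theorem sourceCounit_mul_targetCounit (g h : B) :
    sourceCounit k B g * targetCounit k B h = targetCounit k B h * sourceCounit k B g := by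
  set r := ℛ k (1 : B)
  -- Evaluating the outer legs of 1₁ ⊗ 1₂ ⊗ 1₃ by ε(· h) and ε(g ·) gives the two products, one from
  -- each form of the weak unit axiom.
  have h₁ := congrArg (TensorProduct.lid k B ∘
    TensorProduct.map (counit ∘ₗ LinearMap.mulRight k h)
    ((TensorProduct.rid k B).toLinearMap ∘ₗ (counit ∘ₗ LinearMap.mulLeft k g).lTensor B))
    ((repr_one_sum_tmul_comul r).symm.trans (repr_one_sum_tmul_comul' r))
  simp only [Function.comp_apply, map_sum, TensorProduct.map_tmul, LinearMap.lTensor_tmul,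
    TensorProduct.lid_tmul, TensorProduct.rid_tmul, LinearEquiv.coe_coe,
    LinearMap.comp_apply, LinearMap.mulRight_apply, LinearMap.mulLeft_apply] at h₁
  simp only [sourceCounit_eq_sum r, targetCounit_eq_sum r, Finset.sum_mul, Finset.mul_sum,
    smul_mul_assoc, mul_smul_comm, Finset.smul_sum]
  rw [← h₁, Finset.sum_comm]
  simp only [smul_comm (counit (R := k) (_ * h))]

@[simp]
theorem sourceCounit_sourceCounit (h : B) :
    sourceCounit k B (sourceCounit k B h) = sourceCounit k B h := by
  simpa using sourceCounit_sourceCounit_mul (k := k) h 1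

/-- For x = ε_s(g) and y = ε_s(h), (1 ⊗ xy)Δ(1) = (1 ⊗ x)Δ(y) = Δ(xy), and the counit on the second
leg returns xy. -/
theorem sourceCounit_mul_sourceCounit (g h : B) :
    sourceCounit k B (g * sourceCounit k B h) = sourceCounit k B g * sourceCounit k B h := by
  have h₁ : (1 : B) ⊗ₜ[k] (sourceCounit k B g * sourceCounit k B h) =
      ((1 : B) ⊗ₜ[k] sourceCounit k B g) * ((1 : B) ⊗ₜ[k] sourceCounit k B h) := by simp
  rw [← sourceCounit_sourceCounit_mul, sourceCounit_eq_counitRight (_ * _), h₁, mul_assoc,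
    ← comul_sourceCounit', ← comul_sourceCounit_mul, counitRight_comul]

/-- `1₁ ⊗ ε_s(1₂)` is a separability element for the source subalgebra. -/
theorem sourceCounit_tmul_one_mul (h : B) :
    (sourceCounit k B h ⊗ₜ[k] (1 : B)) *
        TensorProduct.map LinearMap.id (sourceCounit k B) (comul 1) =
      TensorProduct.map LinearMap.id (sourceCounit k B) (comul 1) *
        ((1 : B) ⊗ₜ[k] sourceCounit k B h) := by
  rw [← map_id_sourceCounit_comul, comul_sourceCounit]
  induction comul (R := k) (1 : B) with
  | zero => simp
  | tmul u v => simp [sourceCounit_mul_sourceCounit]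
  | add v w hv hw => simp only [map_add, add_mul, hv, hw]

/-- In ε_s(h) = 1₁ε(h1₂) replace Δ(1) by ε_s(1₂) ⊗ ε_t(1₁), where 1₂ lies in B_t. Hence ε_s maps B_t
onto B_s. -/
theorem exists_sourceCounit_targetCounit_eq (h : B) :
    ∃ h', sourceCounit k B (targetCounit k B h') = sourceCounit k B h := by
  have h₁ (w : B ⊗[k] B) : counitRight k B (((1 : B) ⊗ₜ[k] h) *
      TensorProduct.map (sourceCounit k B) (targetCounit k B) (TensorProduct.comm k B B
        (TensorProduct.map LinearMap.id (targetCounit k B) w))) ∈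
      (sourceCounit k B ∘ₗ targetCounit k B).range := by
    induction w with
    | zero => simp
    | tmul u v =>
      simp only [TensorProduct.map_tmul, TensorProduct.comm_tmul, LinearMap.id_apply,
        Algebra.TensorProduct.tmul_mul_tmul, one_mul, counitRight_tmul]
      exact Submodule.smul_mem _ _ ⟨v, rfl⟩
    | add v w hv hw =>
      simp only [map_add, mul_add]
      exact Submodule.add_mem _ hv hw
  have h₂ := h₁ (comul 1)
  rw [map_id_targetCounit_comul_one, map_sourceCounit_targetCounit_comm_comul_one,
    ← sourceCounit_eq_counitRight] at h₂
  exact h₂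

theorem exists_targetCounit_sourceCounit_eq (h : B) :
    ∃ h', targetCounit k B (sourceCounit k B h') = targetCounit k B h := by
  have h₁ (w : B ⊗[k] B) : counitLeft k B (
      TensorProduct.map (sourceCounit k B) (targetCounit k B) (TensorProduct.comm k B B
        (TensorProduct.map (sourceCounit k B) LinearMap.id w)) * (h ⊗ₜ[k] (1 : B))) ∈
      (targetCounit k B ∘ₗ sourceCounit k B).range := by
    induction w with
    | zero => simp
    | tmul u v =>
      simp only [TensorProduct.map_tmul, TensorProduct.comm_tmul, LinearMap.id_apply,
        Algebra.TensorProduct.tmul_mul_tmul, mul_one, counitLeft_tmul]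
      exact Submodule.smul_mem _ _ ⟨u, rfl⟩
    | add v w hv hw =>
      simp only [map_add, add_mul]
      exact Submodule.add_mem _ hv hw
  have h₂ := h₁ (comul 1)
  rw [map_sourceCounit_id_comul_one, map_sourceCounit_targetCounit_comm_comul_one,
    ← targetCounit_eq_counitLeft] at h₂
  exact h₂

/-- The Nakayama automorphism `ε_s ∘ ε_t` of the source subalgebra fixes its centre. -/
theorem sourceCounit_targetCounit_of_central (c : B)
    (hc : sourceCounit k B c = c)
    (hcomm : ∀ h, sourceCounit k B h * c = c * sourceCounit k B h) :
    sourceCounit k B (targetCounit k B c) = c := by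
  -- Since d lies in B_s, d = 1₁ε(d1₂), so it suffices that ε(d ·) = 0. As ε_t(B) = ε_t(B_s), this
  -- need only be tested on B_s, where centrality of c and the commutation of B_s with B_t give it.
  set d := sourceCounit k B (targetCounit k B c) - c with hd
  have h₁ (h : B) : counit (R := k) (d * sourceCounit k B h) = 0 := by
    rw [hd, sub_mul, map_sub, counit_sourceCounit_mul, ← sourceCounit_mul_targetCounit,
      counit_mul_targetCounit, hcomm, sub_self]
  have h₂ (h : B) : counit (R := k) (d * h) = 0 := by
    obtain ⟨h', hh'⟩ := exists_targetCounit_sourceCounit_eq (k := k) h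
    rw [← counit_mul_targetCounit, ← hh', counit_mul_targetCounit, h₁]
  have h₃ : sourceCounit k B d = d := by
    rw [hd, map_sub, sourceCounit_sourceCounit, hc]
  rw [← sub_eq_zero, ← hd, ← h₃, sourceCounit_eq_sum (ℛ k 1)]
  simp [h₂]

variable (k B) in
/-- The source counital subalgebra. -/
noncomputable def sourceSubalgebra : Subalgebra k B :=
  (sourceSubspace k B).toSubalgebra ⟨1, sourceCounit_one⟩ (by
    rintro _ _ ⟨g, rfl⟩ ⟨h, rfl⟩
    exact ⟨_, sourceCounit_mul_sourceCounit _ _⟩)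

theorem sourceCounit_coe (y : sourceSubalgebra k B) : sourceCounit k B (y : B) = y := by
  obtain ⟨_, h, rfl⟩ := y
  exact sourceCounit_sourceCounit h

variable (k B) in
/-- The source counital map, with values in the source counital subalgebra. -/
noncomputable def toSourceSubalgebra : B →ₗ[k] sourceSubalgebra k B :=
  (sourceCounit k B).codRestrict (Subalgebra.toSubmodule (sourceSubalgebra k B))
    fun h => ⟨h, rfl⟩

theorem coe_toSourceSubalgebra (h : B) :
    (toSourceSubalgebra k B h : B) = sourceCounit k B h := rfl

/-- The source subalgebra is separable. -/
theorem isSeparabilityIdempotent_sourceSubalgebra :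
    IsSeparabilityIdempotent (TensorProduct.map (toSourceSubalgebra k B) (toSourceSubalgebra k B)
      (comul (1 : B))) := by
  let φ := Algebra.TensorProduct.map (sourceSubalgebra k B).val (sourceSubalgebra k B).val
  have hφ : Function.Injective φ := TensorProduct.map_injective_of_flat_flat
    (sourceSubalgebra k B).val.toLinearMap (sourceSubalgebra k B).val.toLinearMap
    Subtype.val_injective Subtype.val_injective
  -- The identities are checked in B ⊗ B, where the idempotent becomes 1₁ ⊗ ε_s(1₂) because 1₁
  -- already lies in B_s.
  have h₁ : φ (TensorProduct.map (toSourceSubalgebra k B) (toSourceSubalgebra k B)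
      (comul (1 : B))) = TensorProduct.map LinearMap.id (sourceCounit k B) (comul 1) := by
    rw [← map_sourceCounit_id_comul_one]
    generalize comul (R := k) (1 : B) = w
    induction w with
    | zero => simp
    | tmul u v => simp [φ, coe_toSourceSubalgebra]
    | add v w hv hw => simp only [map_add, hv, hw]
  have h₂ (w : sourceSubalgebra k B ⊗[k] sourceSubalgebra k B) :
      ((LinearMap.mul' k (sourceSubalgebra k B) w : sourceSubalgebra k B) : B) =
        LinearMap.mul' k B (φ w) := by
    induction w with
    | zero => simp
    | tmul u v => simp [φ]
    | add v w hv hw => simp only [map_add, Subalgebra.coe_add, hv, hw]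
  refine ⟨fun y => hφ ?_, Subtype.val_injective ?_⟩
  · rw [map_mul, map_mul, h₁]
    have := sourceCounit_tmul_one_mul (k := k) (y : B)
    rw [sourceCounit_coe] at this
    simpa [φ] using this
  · rw [h₂, h₁]
    exact LinearMap.congr_fun (convolution_id_sourceCounit (k := k) (B := B)) 1

end CounitalSubalgebras

/-! ### The antipode is antimultiplicative -/

section Antipode

open Coalgebra (comul counit)
open scoped Coalgebra
open TensorProduct

variable {k B : Type*} [Field k] [Ring B] [Algebra k B] [Coalgebra k B]

theorem comul_counitRight (w : B ⊗[k] B) :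
    comul (R := k) (counitRight k B w) =
      TensorProduct.map (counitRight k B) (counitRight k B) (comul (R := k) w) := by
  let φ : B ⊗[k] B →ₗc[k] B := (Coalgebra.TensorProduct.rid k k B).toCoalgHom.comp
    (Coalgebra.TensorProduct.map (CoalgHom.id k B) (Coalgebra.counitCoalgHom k B))
  exact (CoalgHomClass.map_comp_comul_apply φ w).symm

theorem comul_counitLeft (w : B ⊗[k] B) :
    comul (R := k) (counitLeft k B w) =
      TensorProduct.map (counitLeft k B) (counitLeft k B) (comul (R := k) w) := by
  let φ : B ⊗[k] B →ₗc[k] B := (Coalgebra.TensorProduct.lid k B).toCoalgHom.comp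
    (Coalgebra.TensorProduct.map (Coalgebra.counitCoalgHom k B) (CoalgHom.id k B))
  exact (CoalgHomClass.map_comp_comul_apply φ w).symm

theorem comul_tensor_tmul (a b : B) : comul (R := k) (a ⊗ₜ[k] b) =
    TensorProduct.tensorTensorTensorComm k B B B B (comul a ⊗ₜ[k] comul b) := rfl

theorem convolution_comp_counitLeft_apply (g : B →ₗ[k] B) (X : B ⊗[k] B →ₗ[k] B) (a b : B) :
    convolution (g ∘ₗ counitLeft k B) X (a ⊗ₜ b) =
      LinearMap.mul' k B (TensorProduct.map g (X ∘ₗ TensorProduct.mk k B B a) (comul b)) := by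
  have h₁ (v w : B ⊗[k] B) : LinearMap.mul' k B (TensorProduct.map (g ∘ₗ counitLeft k B) X
      (TensorProduct.tensorTensorTensorComm k B B B B (v ⊗ₜ w))) =
      LinearMap.mul' k B (TensorProduct.map g
        (X ∘ₗ TensorProduct.mk k B B (counitLeft k B v)) w) := by
    induction w with
    | zero => simp
    | tmul c d =>
      induction v with
      | zero => simp
      | tmul e f => simp
      | add v w hv hw =>
        simp only [add_tmul, map_add, hv, hw, TensorProduct.map_tmul, LinearMap.comp_add,
          LinearMap.add_apply, tmul_add]
    | add v w hv hw => simp only [tmul_add, map_add, hv, hw]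
  rw [convolution_apply, comul_tensor_tmul, h₁, counitLeft_comul]

theorem convolution_apply_comp_counitRight (g : B →ₗ[k] B) (X : B ⊗[k] B →ₗ[k] B) (a b : B) :
    convolution X (g ∘ₗ counitRight k B) (a ⊗ₜ b) =
      LinearMap.mul' k B (TensorProduct.map (X ∘ₗ (TensorProduct.mk k B B).flip b) g
        (comul a)) := by
  have h₁ (v w : B ⊗[k] B) : LinearMap.mul' k B (TensorProduct.map X (g ∘ₗ counitRight k B)
      (TensorProduct.tensorTensorTensorComm k B B B B (v ⊗ₜ w))) =
      LinearMap.mul' k B (TensorProduct.map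
        (X ∘ₗ (TensorProduct.mk k B B).flip (counitRight k B w)) g v) := by
    induction v with
    | zero => simp
    | tmul c d =>
      induction w with
      | zero => simp
      | tmul e f => simp
      | add v w hv hw =>
        simp only [tmul_add, map_add, hv, hw, TensorProduct.map_tmul, LinearMap.comp_add,
          LinearMap.add_apply, add_tmul]
    | add v w hv hw => simp only [add_tmul, map_add, hv, hw]
  rw [convolution_apply, comul_tensor_tmul, h₁, counitRight_comul]

theorem convolution_counitLeft_counitRight_apply (f g : B →ₗ[k] B) (a b : B) :
    convolution (g ∘ₗ counitLeft k B) (f ∘ₗ counitRight k B) (a ⊗ₜ b) = g b * f a := by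
  rw [convolution_comp_counitLeft_apply]
  have h₁ (w : B ⊗[k] B) : LinearMap.mul' k B (TensorProduct.map g
      ((f ∘ₗ counitRight k B) ∘ₗ TensorProduct.mk k B B a) w) =
      g (counitRight k B w) * f a := by
    induction w with
    | zero => simp
    | tmul c d => simp
    | add v w hv hw => simp only [map_add, add_mul, hv, hw]
  rw [h₁, counitRight_comul]

theorem convolution_counitRight_counitLeft_apply (f g : B →ₗ[k] B) (a b : B) :
    convolution (f ∘ₗ counitRight k B) (g ∘ₗ counitLeft k B) (a ⊗ₜ b) = f a * g b := by
  have h₁ (v w : B ⊗[k] B) : LinearMap.mul' k B (TensorProduct.map (f ∘ₗ counitRight k B)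
      (g ∘ₗ counitLeft k B) (TensorProduct.tensorTensorTensorComm k B B B B (v ⊗ₜ w))) =
      f (counitRight k B v) * g (counitLeft k B w) := by
    induction v with
    | zero => simp
    | tmul c d =>
      induction w with
      | zero => simp
      | tmul e f => simp [smul_smul, mul_comm]
      | add v w hv hw => simp only [tmul_add, map_add, hv, hw, mul_add]
    | add v w hv hw => simp only [add_tmul, map_add, hv, hw, add_mul]
  rw [convolution_apply, comul_tensor_tmul, h₁, counitRight_comul, counitLeft_comul]

variable [IsWeakBialgebra k B]

theorem comul_mul' (w : B ⊗[k] B) :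
    comul (R := k) (LinearMap.mul' k B w) =
      TensorProduct.map (LinearMap.mul' k B) (LinearMap.mul' k B) (comul (R := k) w) := by
  induction w with
  | zero => simp
  | tmul a b =>
    rw [LinearMap.mul'_apply, IsWeakBialgebra.comul_mul, comul_tensor_tmul]
    induction comul (R := k) a with
    | zero => simp
    | tmul c d =>
      induction comul (R := k) b with
      | zero => simp
      | tmul e f => simp
      | add v w hv hw => simp only [tmul_add, map_add, mul_add, hv, hw]
    | add v w hv hw => simp only [add_tmul, map_add, add_mul, hv, hw]
  | add v w hv hw => simp only [map_add, hv, hw]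

variable {S : B →ₗ[k] B} (hS : IsWeakAntipode k B S)

include hS

/-- The antipode of a weak Hopf algebra is antimultiplicative. -/
theorem IsWeakAntipode.map_mul (a b : B) : S (a * b) = S b * S a := by
  -- The computation is in the convolution algebra Hom(B ⊗ B, B). There m = p * q, and Q represents
  -- a ⊗ b ↦ S(b)S(a). Both S ∘ m and Q behave as weak convolution inverses of m, so they agree.
  let p := counitRight k B
  let q := counitLeft k B
  let m := LinearMap.mul' k B
  have hp := comul_counitRight (k := k) (B := B)
  have hq := comul_counitLeft (k := k) (B := B)
  have hm := comul_mul' (k := k) (B := B)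
  have hpq : convolution p q = m :=
    TensorProduct.ext' fun a b =>
      convolution_counitRight_counitLeft_apply LinearMap.id LinearMap.id a b
  have hpp (f g : B →ₗ[k] B) : convolution (f ∘ₗ p) (g ∘ₗ p) = convolution f g ∘ₗ p :=
    (convolution_comp p hp f g).symm
  have hqq (f g : B →ₗ[k] B) : convolution (f ∘ₗ q) (g ∘ₗ q) = convolution f g ∘ₗ q :=
    (convolution_comp q hq f g).symm
  let Q := convolution (S ∘ₗ q) (S ∘ₗ p)
  have h₁ : convolution (S ∘ₗ p) m = convolution (sourceCounit k B ∘ₗ p) q := by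
    rw [← hpq, ← convolution_assoc, ← hS.convolution_left, ← hpp, LinearMap.id_comp]
  have h₉ : convolution q (S ∘ₗ q) = targetCounit k B ∘ₗ q := by
    rw [← hS.convolution_right, ← hqq, LinearMap.id_comp]
  have h₂ : convolution m (S ∘ₗ q) = convolution p (targetCounit k B ∘ₗ q) := by
    rw [← hpq, convolution_assoc, h₉]
  have h₃ : convolution Q m = sourceCounit k B ∘ₗ m := by
    rw [convolution_assoc, h₁]
    refine TensorProduct.ext' fun a b => ?_
    have h (w : B ⊗[k] B) : LinearMap.mul' k B (TensorProduct.map S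
        (convolution (sourceCounit k B ∘ₗ p) q ∘ₗ TensorProduct.mk k B B a) w) =
        LinearMap.mul' k B (TensorProduct.map S LinearMap.id
          (((1 : B) ⊗ₜ[k] sourceCounit k B a) * w)) := by
      induction w with
      | zero => simp
      | tmul c d =>
        have := convolution_counitRight_counitLeft_apply (k := k) (sourceCounit k B)
          LinearMap.id a d
        rw [LinearMap.id_comp] at this
        simp [p, q, this]
      | add v w hv hw => simp only [map_add, mul_add, hv, hw]
    rw [convolution_comp_counitLeft_apply, h, ← comul_sourceCounit_mul, hS.mul_left,
      sourceCounit_sourceCounit_mul]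
    rfl
  have h₄ : convolution m Q = targetCounit k B ∘ₗ m := by
    rw [← convolution_assoc, h₂]
    refine TensorProduct.ext' fun a b => ?_
    have h (w : B ⊗[k] B) : LinearMap.mul' k B (TensorProduct.map
        (convolution p (targetCounit k B ∘ₗ q) ∘ₗ (TensorProduct.mk k B B).flip b) S w) =
        LinearMap.mul' k B (TensorProduct.map LinearMap.id S
          (w * (targetCounit k B b ⊗ₜ[k] (1 : B)))) := by
      induction w with
      | zero => simp
      | tmul c d =>
        have := convolution_counitRight_counitLeft_apply (k := k) LinearMap.id
          (targetCounit k B) c b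
        rw [LinearMap.id_comp] at this
        simp [p, q, this]
      | add v w hv hw => simp only [map_add, add_mul, hv, hw]
    rw [convolution_apply_comp_counitRight, h, ← comul_mul_targetCounit, hS.mul_right,
      targetCounit_mul_targetCounit]
    rfl
  have h₅ : convolution (S ∘ₗ m) m = sourceCounit k B ∘ₗ m := by
    rw [← hS.convolution_left, convolution_comp m hm, LinearMap.id_comp]
  have h₆ : convolution (S ∘ₗ m) (targetCounit k B ∘ₗ m) = S ∘ₗ m := by
    rw [← convolution_comp m hm, hS.convolution_targetCounit]
  have h₇ : convolution (sourceCounit k B ∘ₗ p) (targetCounit k B ∘ₗ q) =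
      convolution (targetCounit k B ∘ₗ q) (sourceCounit k B ∘ₗ p) :=
    TensorProduct.ext' fun a b => by
      rw [convolution_counitRight_counitLeft_apply, convolution_counitLeft_counitRight_apply,
        sourceCounit_mul_targetCounit]
  -- Sm = Sm * m * Q = Q * m * Q. In this last product ε_s ∘ p and ε_t ∘ q appear side by side.
  -- Commuting them lets Sq absorb ε_t ∘ q and Sp absorb ε_s ∘ p, leaving Q.
  have h₈ : S ∘ₗ m = Q := by
    rw [← h₆, ← h₄, ← convolution_assoc, h₅, ← h₃, convolution_assoc Q, convolution_assoc,
      ← convolution_assoc _ m, h₁]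
    change convolution (S ∘ₗ q) (convolution (convolution (sourceCounit k B ∘ₗ p) q)
      (convolution (S ∘ₗ q) (S ∘ₗ p))) = Q
    rw [convolution_assoc _ q, ← convolution_assoc q, h₉, ← convolution_assoc _ _ (S ∘ₗ p), h₇,
      convolution_assoc _ _ (S ∘ₗ p), hpp, hS.convolution_sourceCounit, ← convolution_assoc, hqq,
      hS.convolution_targetCounit]
  exact (LinearMap.congr_fun h₈ (a ⊗ₜ b)).trans (convolution_counitLeft_counitRight_apply S S a b)

/-- On the source subalgebra the antipode is `ε_t`. -/
theorem IsWeakAntipode.map_sourceCounit (h : B) :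
    S (sourceCounit k B h) = targetCounit k B (sourceCounit k B h) := by
  have h₁ (w : B ⊗[k] B) : LinearMap.mul' k B (TensorProduct.map LinearMap.id S
      (((1 : B) ⊗ₜ[k] sourceCounit k B h) * w)) =
      LinearMap.mul' k B (TensorProduct.map LinearMap.id S w) * S (sourceCounit k B h) := by
    induction w with
    | zero => simp
    | tmul u v => simp [hS.map_mul, mul_assoc]
    | add v w hv hw => simp only [map_add, mul_add, add_mul, hv, hw]
  rw [← hS.mul_right, comul_sourceCounit', h₁, hS.mul_right, targetCounit_one, one_mul]

/-- On the target subalgebra the antipode is `ε_s`. -/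
theorem IsWeakAntipode.map_targetCounit (h : B) :
    S (targetCounit k B h) = sourceCounit k B (targetCounit k B h) := by
  have h₁ (w : B ⊗[k] B) : LinearMap.mul' k B (TensorProduct.map S LinearMap.id
      (w * (targetCounit k B h ⊗ₜ[k] (1 : B)))) =
      S (targetCounit k B h) * LinearMap.mul' k B (TensorProduct.map S LinearMap.id w) := by
    induction w with
    | zero => simp
    | tmul u v => simp [hS.map_mul, mul_assoc]
    | add v w hv hw => simp only [map_add, mul_add, add_mul, hv, hw]
  rw [← hS.mul_left, comul_targetCounit', h₁, hS.mul_left, sourceCounit_one, mul_one]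

theorem IsWeakAntipode.map_one : S 1 = 1 := by
  have := hS.map_sourceCounit 1
  rwa [sourceCounit_one, targetCounit_one] at this

end Antipode

/-! ### Convolution with the antipode between spaces of equivariant maps -/

section SourceTargetModules

open Coalgebra (comul counit)
open scoped Coalgebra
open TensorProduct Module

variable {k B A X : Type*} [Field k] [Ring B] [Algebra k B] [Ring A] [Algebra k A]
  [AddCommGroup X] [Module k X]

theorem finrank_submodule_eq_of_inverse {V W : Type*} [AddCommGroup V] [Module k V]
    [AddCommGroup W] [Module k W] (p : Submodule k V) (q : Submodule k W) (F : V →ₗ[k] W)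
    (G : W →ₗ[k] V) (hF : ∀ v ∈ p, F v ∈ q) (hG : ∀ w ∈ q, G w ∈ p)
    (hGF : ∀ v ∈ p, G (F v) = v) (hFG : ∀ w ∈ q, F (G w) = w) :
    finrank k p = finrank k q :=
  LinearEquiv.finrank_eq (LinearEquiv.ofLinearMap (F.restrict hF) (G.restrict hG)
    (LinearMap.ext fun w => Subtype.ext (hFG w w.2))
    (LinearMap.ext fun v => Subtype.ext (hGF v v.2)))

theorem mul'_map_mul_tmul_one (φ : B →ₗ[k] A) (f : B →ₗ[k] A) (x : B) (a : A)
    (h : ∀ u, φ (u * x) = a * φ u) (w : B ⊗[k] B) :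
    LinearMap.mul' k A (TensorProduct.map φ f (w * (x ⊗ₜ[k] (1 : B)))) =
      a * LinearMap.mul' k A (TensorProduct.map φ f w) := by
  induction w with
  | zero => simp
  | tmul u v => simp [h, mul_assoc]
  | add v w hv hw => simp only [add_mul, map_add, mul_add, hv, hw]

theorem mul'_map_tmul_one_mul (φ : B →ₗ[k] A) (f : B →ₗ[k] A) (x : B) (a : A)
    (h : ∀ u, φ (x * u) = a * φ u) (w : B ⊗[k] B) :
    LinearMap.mul' k A (TensorProduct.map φ f ((x ⊗ₜ[k] (1 : B)) * w)) =
      a * LinearMap.mul' k A (TensorProduct.map φ f w) := by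
  induction w with
  | zero => simp
  | tmul u v => simp [h, mul_assoc]
  | add v w hv hw => simp only [map_add, mul_add, hv, hw]

theorem mul'_map_mul_one_tmul (φ : B →ₗ[k] A) (f : B →ₗ[k] A) (x : B) (a : A)
    (h : ∀ u, f (u * x) = f u * a) (w : B ⊗[k] B) :
    LinearMap.mul' k A (TensorProduct.map φ f (w * ((1 : B) ⊗ₜ[k] x))) =
      LinearMap.mul' k A (TensorProduct.map φ f w) * a := by
  induction w with
  | zero => simp
  | tmul u v => simp [h, mul_assoc]
  | add v w hv hw => simp only [add_mul, map_add, hv, hw]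

theorem mul'_map_one_tmul_mul (φ : B →ₗ[k] A) (f : B →ₗ[k] A) (x : B) (a : A)
    (h : ∀ u, f (x * u) = f u * a) (w : B ⊗[k] B) :
    LinearMap.mul' k A (TensorProduct.map φ f (((1 : B) ⊗ₜ[k] x) * w)) =
      LinearMap.mul' k A (TensorProduct.map φ f w) * a := by
  induction w with
  | zero => simp
  | tmul u v => simp [h, mul_assoc]
  | add v w hv hw => simp only [mul_add, map_add, add_mul, hv, hw]

variable [Coalgebra k B]

/-- Left convolution by `φ` as a linear operator on maps into a space identified with `A`. -/
noncomputable def convolutionLeft (e : X ≃ₗ[k] A) (φ : B →ₗ[k] A) :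
    (B →ₗ[k] X) →ₗ[k] (B →ₗ[k] X) where
  toFun f := e.symm.toLinearMap ∘ₗ convolution φ (e.toLinearMap ∘ₗ f)
  map_add' f g := by
    simp [convolution, LinearMap.comp_add, LinearMap.add_comp, TensorProduct.map_add_right]
  map_smul' c f := by
    simp [convolution, LinearMap.comp_smul, LinearMap.smul_comp, TensorProduct.map_smul_right]

/-- Right convolution by `φ` as a linear operator on maps into a space identified with `A`. -/
noncomputable def convolutionRight (e : X ≃ₗ[k] A) (φ : B →ₗ[k] A) :
    (B →ₗ[k] X) →ₗ[k] (B →ₗ[k] X) where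
  toFun f := e.symm.toLinearMap ∘ₗ convolution (e.toLinearMap ∘ₗ f) φ
  map_add' f g := by
    simp [convolution, LinearMap.comp_add, LinearMap.add_comp, TensorProduct.map_add_left]
  map_smul' c f := by
    simp [convolution, LinearMap.comp_smul, LinearMap.smul_comp, TensorProduct.map_smul_left]

theorem comp_convolutionLeft (e : X ≃ₗ[k] A) (φ : B →ₗ[k] A) (f : B →ₗ[k] X) :
    e.toLinearMap ∘ₗ convolutionLeft e φ f = convolution φ (e.toLinearMap ∘ₗ f) := by
  ext b
  exact e.apply_symm_apply _

theorem comp_convolutionRight (e : X ≃ₗ[k] A) (φ : B →ₗ[k] A) (f : B →ₗ[k] X) :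
    e.toLinearMap ∘ₗ convolutionRight e φ f = convolution (e.toLinearMap ∘ₗ f) φ := by
  ext b
  exact e.apply_symm_apply _

theorem IsWeakAntipode.convolution_comp_left {S : B →ₗ[k] B}
    (hS : IsWeakAntipode k B S) (ρ : B →ₐ[k] A) :
    convolution (ρ.toLinearMap ∘ₗ S) ρ.toLinearMap = ρ.toLinearMap ∘ₗ sourceCounit k B := by
  rw [← hS.convolution_left, algHom_comp_convolution, LinearMap.comp_id]

theorem IsWeakAntipode.convolution_comp_right {S : B →ₗ[k] B}
    (hS : IsWeakAntipode k B S) (ρ : B →ₐ[k] A) :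
    convolution ρ.toLinearMap (ρ.toLinearMap ∘ₗ S) = ρ.toLinearMap ∘ₗ targetCounit k B := by
  rw [← hS.convolution_right, algHom_comp_convolution, LinearMap.comp_id]

variable [IsWeakBialgebra k B]

/-- Equivariance moves ε_t(b₁) inside f, where ε_t(b₁)b₂ = b. -/
theorem convolution_targetCounit_of_equivariant (ρ : B →ₐ[k] A) (f : B →ₗ[k] A)
    (hf : ∀ h b, f (targetCounit k B h * b) = ρ (targetCounit k B h) * f b) :
    convolution (ρ.toLinearMap ∘ₗ targetCounit k B) f = f := by
  have h₁ (w : B ⊗[k] B) : LinearMap.mul' k A (TensorProduct.map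
      (ρ.toLinearMap ∘ₗ targetCounit k B) f w) =
      f (LinearMap.mul' k B (TensorProduct.map (targetCounit k B) LinearMap.id w)) := by
    induction w with
    | zero => simp
    | tmul u v => simp [hf]
    | add v w hv hw => simp only [map_add, hv, hw]
  ext b
  rw [convolution_apply, h₁, ← convolution_apply, convolution_targetCounit_id, LinearMap.id_apply]

theorem convolution_sourceCounit_of_equivariant (ρ : B →ₐ[k] A) (f : B →ₗ[k] A)
    (hf : ∀ h b, f (b * sourceCounit k B h) = f b * ρ (sourceCounit k B h)) :
    convolution f (ρ.toLinearMap ∘ₗ sourceCounit k B) = f := by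
  have h₁ (w : B ⊗[k] B) : LinearMap.mul' k A (TensorProduct.map
      f (ρ.toLinearMap ∘ₗ sourceCounit k B) w) =
      f (LinearMap.mul' k B (TensorProduct.map LinearMap.id (sourceCounit k B) w)) := by
    induction w with
    | zero => simp
    | tmul u v => simp [hf]
    | add v w hv hw => simp only [map_add, hv, hw]
  ext b
  rw [convolution_apply, h₁, ← convolution_apply, convolution_id_sourceCounit, LinearMap.id_apply]

variable {S : B →ₗ[k] B} (hS : IsWeakAntipode k B S)

include hS

/-- Since ε_s(b₁) ⊗ b₂ = 1₁ ⊗ b1₂ with 1₂ in B_t, the factor 1₂ leaves g through S, and 1₁S(1₂) =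
ε_t(1) = 1 remains. -/
theorem IsWeakAntipode.convolution_sourceCounit_of_equivariant (ρ : B →ₐ[k] A) (g : B →ₗ[k] A)
    (hg : ∀ h b, g (b * targetCounit k B h) = ρ (S (targetCounit k B h)) * g b) :
    convolution (ρ.toLinearMap ∘ₗ sourceCounit k B) g = g := by
  ext b
  have h₁ (w : B ⊗[k] B) : LinearMap.mul' k A (TensorProduct.map ρ.toLinearMap g
      (((1 : B) ⊗ₜ[k] b) * TensorProduct.map LinearMap.id (targetCounit k B) w)) =
      ρ (LinearMap.mul' k B (TensorProduct.map LinearMap.id S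
        (TensorProduct.map LinearMap.id (targetCounit k B) w))) * g b := by
    induction w with
    | zero => simp
    | tmul u v => simp [hg, mul_assoc]
    | add v w hv hw => simp only [map_add, mul_add, add_mul, hv, hw]
  have h₂ : TensorProduct.map (ρ.toLinearMap ∘ₗ sourceCounit k B) g (comul b) =
      TensorProduct.map ρ.toLinearMap g
        (TensorProduct.map (sourceCounit k B) LinearMap.id (comul b)) := by
    conv_lhs => rw [← LinearMap.comp_id g, TensorProduct.map_comp]
    rfl
  rw [convolution_apply, h₂, map_sourceCounit_id_comul, ← map_id_targetCounit_comul_one, h₁,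
    map_id_targetCounit_comul_one, hS.mul_right, targetCounit_one, _root_.map_one, one_mul]

theorem IsWeakAntipode.convolution_targetCounit_of_equivariant (ρ : B →ₐ[k] A) (g : B →ₗ[k] A)
    (hg : ∀ h b, g (sourceCounit k B h * b) = g b * ρ (S (sourceCounit k B h))) :
    convolution g (ρ.toLinearMap ∘ₗ targetCounit k B) = g := by
  ext b
  have h₁ (w : B ⊗[k] B) : LinearMap.mul' k A (TensorProduct.map g ρ.toLinearMap
      (TensorProduct.map (sourceCounit k B) LinearMap.id w * (b ⊗ₜ[k] (1 : B)))) =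
      g b * ρ (LinearMap.mul' k B (TensorProduct.map S LinearMap.id
        (TensorProduct.map (sourceCounit k B) LinearMap.id w))) := by
    induction w with
    | zero => simp
    | tmul u v => simp [hg, mul_assoc]
    | add v w hv hw => simp only [map_add, mul_add, add_mul, hv, hw]
  have h₂ : TensorProduct.map g (ρ.toLinearMap ∘ₗ targetCounit k B) (comul b) =
      TensorProduct.map g ρ.toLinearMap
        (TensorProduct.map LinearMap.id (targetCounit k B) (comul b)) := by
    conv_lhs => rw [← LinearMap.comp_id g, TensorProduct.map_comp]
    rfl
  rw [convolution_apply, h₂, map_id_targetCounit_comul, ← map_sourceCounit_id_comul_one, h₁,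
    map_sourceCounit_id_comul_one, hS.mul_left, sourceCounit_one, _root_.map_one, mul_one]

/-- Left convolution by the antipode turns maps that are equivariant for left multiplication by
the target subalgebra into maps that are equivariant for right multiplication. -/
theorem IsWeakAntipode.finrank_targetEquivariant (e : X ≃ₗ[k] A) (ρ : B →ₐ[k] A)
    (p q : Submodule k (B →ₗ[k] X))
    (hp : ∀ f, f ∈ p ↔
      ∀ h b, e (f (targetCounit k B h * b)) = ρ (targetCounit k B h) * e (f b))
    (hq : ∀ f, f ∈ q ↔
      ∀ h b, e (f (b * targetCounit k B h)) = ρ (S (targetCounit k B h)) * e (f b)) :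
    finrank k p = finrank k q := by
  have he {f g : B →ₗ[k] X} (h : e.toLinearMap ∘ₗ f = e.toLinearMap ∘ₗ g) : f = g :=
    LinearMap.ext fun b => e.injective (LinearMap.congr_fun h b)
  have hc (φ : B →ₗ[k] A) (f : B →ₗ[k] X) (b : B) : e (convolutionLeft e φ f b) =
      LinearMap.mul' k A (TensorProduct.map φ (e.toLinearMap ∘ₗ f) (comul b)) :=
    LinearMap.congr_fun (comp_convolutionLeft e φ f) b
  -- The inverse is convolution by ρ: ρ * (ρ ∘ S) = ρ ∘ ε_t and (ρ ∘ S) * ρ = ρ ∘ ε_s act as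
  -- identities on the respective spaces. The identification e allows A to be B or its opposite.
  refine finrank_submodule_eq_of_inverse p q (convolutionLeft e (ρ.toLinearMap ∘ₗ S))
    (convolutionLeft e ρ.toLinearMap) (fun f _ => (hq _).2 fun h b => ?_)
    (fun f _ => (hp _).2 fun h b => ?_) (fun f hf => he ?_) (fun f hf => he ?_)
  · rw [hc, hc, comul_mul_targetCounit]
    exact mul'_map_mul_tmul_one _ _ _ _ (fun u => by simp [hS.map_mul]) _
  · rw [hc, hc, comul_targetCounit_mul]
    exact mul'_map_tmul_one_mul _ _ _ _ (fun u => by simp) _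
  · rw [comp_convolutionLeft, comp_convolutionLeft, ← convolution_assoc,
      hS.convolution_comp_right,
      _root_.convolution_targetCounit_of_equivariant ρ _ ((hp f).1 hf)]
  · rw [comp_convolutionLeft, comp_convolutionLeft, ← convolution_assoc,
      hS.convolution_comp_left, hS.convolution_sourceCounit_of_equivariant ρ _ ((hq f).1 hf)]

/-- Right convolution by the antipode turns maps that are equivariant for right multiplication by
the source subalgebra into maps that are equivariant for left multiplication. -/
theorem IsWeakAntipode.finrank_sourceEquivariant (e : X ≃ₗ[k] A) (ρ : B →ₐ[k] A)
    (p q : Submodule k (B →ₗ[k] X))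
    (hp : ∀ f, f ∈ p ↔
      ∀ h b, e (f (b * sourceCounit k B h)) = e (f b) * ρ (sourceCounit k B h))
    (hq : ∀ f, f ∈ q ↔
      ∀ h b, e (f (sourceCounit k B h * b)) = e (f b) * ρ (S (sourceCounit k B h))) :
    finrank k p = finrank k q := by
  have he {f g : B →ₗ[k] X} (h : e.toLinearMap ∘ₗ f = e.toLinearMap ∘ₗ g) : f = g :=
    LinearMap.ext fun b => e.injective (LinearMap.congr_fun h b)
  have hc (φ : B →ₗ[k] A) (f : B →ₗ[k] X) (b : B) : e (convolutionRight e φ f b) =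
      LinearMap.mul' k A (TensorProduct.map (e.toLinearMap ∘ₗ f) φ (comul b)) :=
    LinearMap.congr_fun (comp_convolutionRight e φ f) b
  refine finrank_submodule_eq_of_inverse p q (convolutionRight e (ρ.toLinearMap ∘ₗ S))
    (convolutionRight e ρ.toLinearMap) (fun f _ => (hq _).2 fun h b => ?_)
    (fun f _ => (hp _).2 fun h b => ?_) (fun f hf => he ?_) (fun f hf => he ?_)
  · rw [hc, hc, comul_sourceCounit_mul]
    exact mul'_map_one_tmul_mul _ _ _ _ (fun u => by simp [hS.map_mul]) _
  · rw [hc, hc, comul_mul_sourceCounit]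
    exact mul'_map_mul_one_tmul _ _ _ _ (fun u => by simp) _
  · rw [comp_convolutionRight, comp_convolutionRight, convolution_assoc,
      hS.convolution_comp_left,
      _root_.convolution_sourceCounit_of_equivariant ρ _ ((hp f).1 hf)]
  · rw [comp_convolutionRight, comp_convolutionRight, convolution_assoc,
      hS.convolution_comp_right, hS.convolution_targetCounit_of_equivariant ρ _ ((hq f).1 hf)]

end SourceTargetModules

/-! ### The four B_s-module structures on B and their comparison -/

section SourceModules

open Coalgebra (comul counit)
open Module

variable {k B : Type*} [Field k] [Ring B] [Algebra k B] [Coalgebra k B] [IsWeakBialgebra k B]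

variable (k B) in
/-- Left multiplication by the source subalgebra. -/
noncomputable def sourceLeftRep : sourceSubalgebra k B →ₐ[k] End k B :=
  (Algebra.lmul k B).comp (sourceSubalgebra k B).val

@[simp]
theorem sourceLeftRep_apply (y : sourceSubalgebra k B) (b : B) :
    sourceLeftRep k B y b = y * b := rfl

variable (k B) in
/-- Right multiplication by the source subalgebra. -/
noncomputable def sourceRightRep : (sourceSubalgebra k B)ᵐᵒᵖ →ₐ[k] End k B where
  toFun y := LinearMap.mulRight k (y.unop : B)
  map_one' := by ext; simp
  map_mul' x y := by ext; simp [mul_assoc]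
  map_zero' := by ext; simp
  map_add' x y := by ext; simp [mul_add]
  commutes' c := by ext; simp [Algebra.algebraMap_eq_smul_one]

@[simp]
theorem sourceRightRep_apply (y : (sourceSubalgebra k B)ᵐᵒᵖ) (b : B) :
    sourceRightRep k B y b = b * y.unop := rfl

theorem forall_sourceCounit_iff (P : B → Prop) :
    (∀ h, P (sourceCounit k B h)) ↔ ∀ y : sourceSubalgebra k B, P y :=
  ⟨fun H ⟨_, h, hh⟩ => hh ▸ H h, fun H h => H ⟨_, h, rfl⟩⟩

variable {S : B →ₗ[k] B} (hS : IsWeakAntipode k B S)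

namespace IsWeakAntipode

/-- The source subalgebra acting by right multiplication through the antipode. -/
noncomputable def rightRep : sourceSubalgebra k B →ₐ[k] End k B where
  toFun y := LinearMap.mulRight k (S y)
  map_one' := by ext; simp [hS.map_one]
  map_mul' x y := by ext; simp [hS.map_mul, mul_assoc]
  map_zero' := by ext; simp
  map_add' x y := by ext; simp [mul_add]
  commutes' c := by ext; simp [Algebra.algebraMap_eq_smul_one, hS.map_one]

/-- The source subalgebra acting by left multiplication through the antipode. -/
noncomputable def leftRep : (sourceSubalgebra k B)ᵐᵒᵖ →ₐ[k] End k B where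
  toFun y := LinearMap.mulLeft k (S (y.unop : B))
  map_one' := by ext; simp [hS.map_one]
  map_mul' x y := by ext; simp [hS.map_mul]
  map_zero' := by ext; simp
  map_add' x y := by ext; simp [add_mul]
  commutes' c := by ext; simp [Algebra.algebraMap_eq_smul_one, hS.map_one]

@[simp]
theorem rightRep_apply (y : sourceSubalgebra k B) (b : B) : hS.rightRep y b = b * S y := rfl

@[simp]
theorem leftRep_apply (y : (sourceSubalgebra k B)ᵐᵒᵖ) (b : B) :
    hS.leftRep y b = S (y.unop : B) * b := rfl

include hS in
theorem map_map_sourceCounit (h : B) :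
    S (S (sourceCounit k B h)) =
      sourceCounit k B (targetCounit k B (sourceCounit k B h)) := by
  rw [hS.map_sourceCounit, hS.map_targetCounit]

/-- The square of the antipode on the source subalgebra. -/
noncomputable def sqSource : sourceSubalgebra k B →ₐ[k] sourceSubalgebra k B where
  toFun y := ⟨S (S y), by
    obtain ⟨_, h, rfl⟩ := y
    exact ⟨_, (hS.map_map_sourceCounit h).symm⟩⟩
  map_one' := by ext; simp [hS.map_one]
  map_mul' x y := by ext; simp [hS.map_mul]
  map_zero' := by ext; simp
  map_add' x y := by ext; simp
  commutes' c := by ext; simp [Algebra.algebraMap_eq_smul_one, hS.map_one]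

@[simp]
theorem coe_sqSource (y : sourceSubalgebra k B) : (hS.sqSource y : B) = S (S y) := rfl

theorem sqSource_surjective : Function.Surjective hS.sqSource := by
  rintro ⟨_, h, rfl⟩
  obtain ⟨h', hh'⟩ := exists_sourceCounit_targetCounit_eq (k := k) h
  obtain ⟨h'', hh''⟩ := exists_targetCounit_sourceCounit_eq (k := k) h'
  refine ⟨⟨_, h'', rfl⟩, Subtype.ext ?_⟩
  rw [coe_sqSource, hS.map_map_sourceCounit, hh'', hh']

theorem sqSource_of_central (c : sourceSubalgebra k B) (hc : ∀ r, r * c = c * r) :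
    hS.sqSource c = c := by
  have h₁ := sourceCounit_coe c
  have h₂ := hS.map_map_sourceCounit (c : B)
  rw [h₁] at h₂
  refine Subtype.ext (h₂.trans (sourceCounit_targetCounit_of_central _ h₁ fun h => ?_))
  exact congrArg Subtype.val (hc ⟨_, h, rfl⟩)

include hS in
-- This is B_t = S(B_s), which turns B_t-equivariance into equivariance for B_s acting through S.
theorem forall_targetCounit_iff (P : B → Prop) :
    (∀ h, P (targetCounit k B h)) ↔ ∀ y : sourceSubalgebra k B, P (S y) := by
  constructor
  · rintro H ⟨_, h, rfl⟩
    rw [hS.map_sourceCounit]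
    exact H _
  · intro H h
    obtain ⟨h', hh'⟩ := exists_targetCounit_sourceCounit_eq (k := k) h
    rw [← hh', ← hS.map_sourceCounit]
    exact H ⟨_, h', rfl⟩

/-- The antipode as an algebra homomorphism to the opposite algebra. -/
noncomputable def toOp : B →ₐ[k] Bᵐᵒᵖ where
  toFun b := MulOpposite.op (S b)
  map_one' := by simp [hS.map_one]
  map_mul' x y := by simp [hS.map_mul]
  map_zero' := by simp
  map_add' x y := by simp
  commutes' c := by simp [Algebra.algebraMap_eq_smul_one, hS.map_one]

@[simp]
theorem toOp_apply (b : B) : hS.toOp b = MulOpposite.op (S b) := rfl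

/-- Convolution turns f(zb) = zf(b) on B_t into g(bz) = S(z)g(b). Putting z = S(y) produces the
twist by S². -/
theorem finrank_intertwiners_leftRep_leftRep :
    finrank k (intertwiners hS.leftRep hS.leftRep) =
      finrank k (intertwiners hS.rightRep ((sourceLeftRep k B).comp hS.sqSource)) := by
  refine hS.finrank_targetEquivariant (LinearEquiv.refl k B) (AlgHom.id k B) _ _ (fun f => ?_)
    fun f => ?_
  · rw [hS.forall_targetCounit_iff fun z => ∀ b,
      LinearEquiv.refl k B (f (z * b)) = AlgHom.id k B z * LinearEquiv.refl k B (f b),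
      mem_intertwiners]
    exact ⟨fun H y => H (MulOpposite.op y), fun H r => H r.unop⟩
  · rw [hS.forall_targetCounit_iff fun z => ∀ b,
      LinearEquiv.refl k B (f (b * z)) = AlgHom.id k B (S z) * LinearEquiv.refl k B (f b)]
    exact Iff.rfl

theorem finrank_intertwiners_sourceRightRep_sourceRightRep :
    finrank k (intertwiners (sourceRightRep k B) (sourceRightRep k B)) =
      finrank k (intertwiners (sourceLeftRep k B) hS.rightRep) := by
  refine hS.finrank_sourceEquivariant (LinearEquiv.refl k B) (AlgHom.id k B) _ _ (fun f => ?_)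
    fun f => ?_
  · rw [forall_sourceCounit_iff fun z => ∀ b,
      LinearEquiv.refl k B (f (b * z)) = LinearEquiv.refl k B (f b) * AlgHom.id k B z,
      mem_intertwiners]
    exact ⟨fun H y => H (MulOpposite.op y), fun H r => H r.unop⟩
  · rw [forall_sourceCounit_iff fun z => ∀ b,
      LinearEquiv.refl k B (f (z * b)) = LinearEquiv.refl k B (f b) * AlgHom.id k B (S z)]
    exact Iff.rfl

/-- Taking A to be the opposite algebra and ρ the antipode, multiplication by ρ(z) on the left of A
is right multiplication by S(z) in B. -/
theorem finrank_intertwiners_leftRep_sourceRightRep :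
    finrank k (intertwiners hS.leftRep ((sourceRightRep k B).comp (AlgHom.op hS.sqSource))) =
      finrank k (intertwiners hS.rightRep (hS.rightRep.comp hS.sqSource)) := by
  refine hS.finrank_targetEquivariant (MulOpposite.opLinearEquiv k) hS.toOp _ _ (fun f => ?_)
    fun f => ?_
  · rw [hS.forall_targetCounit_iff fun z => ∀ b,
      MulOpposite.opLinearEquiv k (f (z * b)) = hS.toOp z * MulOpposite.opLinearEquiv k (f b),
      mem_intertwiners]
    refine Iff.trans ?_ MulOpposite.opEquiv.forall_congr_left.symm
    simp [← MulOpposite.op_mul]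
  · rw [hS.forall_targetCounit_iff fun z => ∀ b,
      MulOpposite.opLinearEquiv k (f (b * z)) = hS.toOp (S z) * MulOpposite.opLinearEquiv k (f b),
      mem_intertwiners]
    simp [← MulOpposite.op_mul]

theorem finrank_intertwiners_sourceRightRep_leftRep :
    finrank k (intertwiners (sourceRightRep k B) hS.leftRep) =
      finrank k (intertwiners (sourceLeftRep k B) ((sourceLeftRep k B).comp hS.sqSource)) := by
  refine hS.finrank_sourceEquivariant (MulOpposite.opLinearEquiv k) hS.toOp _ _ (fun f => ?_)
    fun f => ?_
  · rw [forall_sourceCounit_iff fun z => ∀ b,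
      MulOpposite.opLinearEquiv k (f (b * z)) = MulOpposite.opLinearEquiv k (f b) * hS.toOp z,
      mem_intertwiners]
    refine Iff.trans ?_ MulOpposite.opEquiv.forall_congr_left.symm
    simp [← MulOpposite.op_mul]
  · rw [forall_sourceCounit_iff fun z => ∀ b,
      MulOpposite.opLinearEquiv k (f (z * b)) = MulOpposite.opLinearEquiv k (f b) * hS.toOp (S z),
      mem_intertwiners]
    simp [← MulOpposite.op_mul]

include hS in
/-- In a finite-dimensional weak Hopf algebra the source and target modules are isomorphic. -/
theorem sourceTargetModulesIsomorphic [FiniteDimensional k B] :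
    SourceTargetModulesIsomorphic k B := by
  have he := isSeparabilityIdempotent_sourceSubalgebra (k := k) (B := B)
  have := he.isSemisimpleRing
  have twist {X : Type _} [AddCommGroup X] [Module k X] [FiniteDimensional k X]
      (ρ : sourceSubalgebra k B →ₐ[k] End k X) :=
    he.exists_comp_equiv hS.sqSource hS.sqSource_surjective hS.sqSource_of_central ρ
  have twistOp := he.op.exists_comp_equiv (AlgHom.op hS.sqSource)
    (fun y => by
      obtain ⟨x, hx⟩ := hS.sqSource_surjective y.unop
      exact ⟨MulOpposite.op x, MulOpposite.unop_injective hx⟩)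
    (fun c hc => MulOpposite.unop_injective (hS.sqSource_of_central c.unop fun r =>
      (congrArg MulOpposite.unop (hc (MulOpposite.op r))).symm))
    (sourceRightRep k B)
  have refl {Γ : Type _} [Ring Γ] [Algebra k Γ] (ρ : Γ →ₐ[k] End k B) :
      ∃ g : B ≃ₗ[k] B, ∀ r x, g (ρ r x) = ρ r (g x) := ⟨LinearEquiv.refl k B, fun _ _ => rfl⟩
  have h₁ := hS.finrank_intertwiners_leftRep_leftRep
  rw [finrank_intertwiners_congr (refl hS.rightRep) (twist (sourceLeftRep k B))] at h₁
  have h₂ := hS.finrank_intertwiners_sourceRightRep_sourceRightRep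
  have h₃ := hS.finrank_intertwiners_leftRep_sourceRightRep
  rw [finrank_intertwiners_congr (refl hS.rightRep) (twist hS.rightRep),
    finrank_intertwiners_congr (refl hS.leftRep) twistOp] at h₃
  have h₄ := hS.finrank_intertwiners_sourceRightRep_leftRep
  rw [finrank_intertwiners_congr (refl (sourceLeftRep k B)) (twist (sourceLeftRep k B))] at h₄
  -- Nonnegativity of the defect for the left modules is, by the four equalities, the reverse
  -- inequality for the right modules, which forces the isomorphism.
  have h₅ := finrank_intertwiners_add_le hS.rightRep (sourceLeftRep k B)
  obtain ⟨f, hf⟩ := exists_linearEquiv_of_finrank_intertwiners_le (sourceRightRep k B) hS.leftRep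
    (by omega)
  refine ⟨f, ?_⟩
  rintro _ ⟨h, rfl⟩ b
  rw [← hS.map_sourceCounit]
  exact hf (MulOpposite.op ⟨_, h, rfl⟩) b

end IsWeakAntipode

end SourceModules

/-! ### The equivalence for quotients -/

theorem mainTheorem10 (k : Type*) (H : Type*) [Field k] [Ring H] [Algebra k H] [Coalgebra k H]
    [IsWeakHopfAlgebra k H]
    (I : Ideal H) [I.IsTwoSided] [(I.restrictScalars k).IsCoideal]
    [FiniteDimensional k (H ⧸ I)] :
    IsWeakHopfAlgebra k (H ⧸ I) ↔ SourceTargetModulesIsomorphic k (H ⧸ I) := by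
  constructor
  · intro h
    obtain ⟨S, hS⟩ := h.exists_antipode
    exact hS.sourceTargetModulesIsomorphic
  · intro h
    obtain ⟨S, hS⟩ := IsWeakHopfAlgebra.exists_antipode (k := k) (H := H)
    exact { exists_antipode := exists_isWeakAntipode_of_surjective (Ideal.Quotient.mkₐ k I)
              (quotientCoalgebra_comul_mk I) (quotientCoalgebra_counit_mk I) hS
              (Ideal.Quotient.mkₐ_surjective k I) h }
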